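/- For $n\ge 1$ let $\mathbb R[x]_{\le d}$ be the space of real polynomials in $x=(x_1,\dots,x_n)$ of degree at most $d$. A degree-$4$ pseudo-distribution satisfying $\{\|x\|^2=1\}$ is a linear functional $\tilde{\mathbb E}:\mathbb R[x]_{\le 4}\to\mathbb R$ with $\tilde{\mathbb E}\,1=1$, with $\tilde{\mathbb E}\,p^2\ge 0$ for all $p\in\mathbb R[x]_{\le 2}$, and with $\tilde{\mathbb E}\,(\|x\|^2-1)q=0$ for every polynomial $q$ such that $(\|x\|^2-1)q\in\mathbb R[x]_{\le 4}$. For a $3$-tensor $\mathbf A\in\mathbb R^{n\times n\times n}$ write $\mathbf A(x)=\sum_{i,j,k}\mathbf A_{ijk}x_ix_jx_k$. Theorem. There are a function $\tau:\mathbb N\to\mathbb R$ with $\tau(n)=\Omega\big(n^{3/4}/(\log n)^{1/4}\big)$, that is, $\tau(n)\ge c\,n^{3/4}/(\log n)^{1/4}$ for all $n\ge2$ and some constant $c>0$; for every $n\ge1$ a map $\eta=\eta_n$ from $3$-tensors to degree-$4$ pseudo-distributions satisfying $\{\|x\|^2=1\}$; and constants $K>0$, $k\in\mathbb N$, $C$,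 such that for every $n\ge 2$ the following holds. If $\mathbf A$ has independent standard Gaussian entries, then, with probability at least $1-C n^{-10}$ over $\mathbf A$, for every unit vector $v_0\in\mathbb R^n$ and every degree-$4$ pseudo-distribution $\tilde{\mathbb E}'$ satisfying $\{\|x\|^2=1\}$, $$\tilde{\mathbb E}'\big[\tau(n)\langle v_0,x\rangle^3+\mathbf A(x)\big]\;\le\;K(\log n)^k\cdot\tilde{\mathbb E}_{x\sim\eta(\mathbf A)}\big[\tau(n)\langle v_0,x\rangle^3+\mathbf A(x)\big].$$ In particular $\eta$ depends only on the noise tensor $\mathbf A$ and not on $v_0$. -/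

import Mathlib

open MeasureTheory ProbabilityTheory

noncomputable section

namespace SoS

/-- `ℝ[x]_{≤ d}`: real polynomials in `x_0, …, x_{n-1}` of total degree at most `d`. -/
abbrev PolyLE (n d : ℕ) : Submodule ℝ (MvPolynomial (Fin n) ℝ) :=
  MvPolynomial.restrictTotalDegree (Fin n) ℝ d

theorem mem_polyLE {n d : ℕ} {p : MvPolynomial (Fin n) ℝ} :
    p ∈ PolyLE n d ↔ p.totalDegree ≤ d :=
  MvPolynomial.mem_restrictTotalDegree (Fin n) d p

theorem one_mem (n d : ℕ) : (1 : MvPolynomial (Fin n) ℝ) ∈ PolyLE n d := by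
  rw [mem_polyLE]; simp

theorem sq_mem {n d : ℕ} {p : MvPolynomial (Fin n) ℝ} (hp : p ∈ PolyLE n (d / 2)) :
    p ^ 2 ∈ PolyLE n d := by
  rw [mem_polyLE] at hp ⊢
  have := MvPolynomial.totalDegree_pow p 2
  omega

/-- `L` is a degree-`d` pseudo-expectation (equivalently, a degree-`d` pseudo-distribution):
a linear functional on `ℝ[x]_{≤ d}` with `L 1 = 1` and `L (p ^ 2) ≥ 0` for all
`p ∈ ℝ[x]_{≤ d/2}`. -/
structure IsPseudoExpectation {n d : ℕ} (L : PolyLE n d →ₗ[ℝ] ℝ) : Prop where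
  map_one : L ⟨1, one_mem n d⟩ = 1
  nonneg_sq : ∀ (p : MvPolynomial (Fin n) ℝ) (hp : p ∈ PolyLE n (d / 2)),
    0 ≤ L ⟨p ^ 2, sq_mem hp⟩

/-- `L` satisfies the constraint `{p = 0}`: `L (p * q) = 0` for every `q` such that
`p * q ∈ ℝ[x]_{≤ d}`. -/
def Satisfies {n d : ℕ} (L : PolyLE n d →ₗ[ℝ] ℝ) (p : MvPolynomial (Fin n) ℝ) : Prop :=
  ∀ (q : MvPolynomial (Fin n) ℝ) (h : p * q ∈ PolyLE n d), L ⟨p * q, h⟩ = 0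

/-- The polynomial `‖x‖² - 1`. -/
def spherePoly (n : ℕ) : MvPolynomial (Fin n) ℝ :=
  (∑ i, MvPolynomial.X i ^ 2) - 1

/-- Degree-4 pseudo-distributions on `ℝⁿ` satisfying `{‖x‖² = 1}`. -/
structure IsSpherePseudoDist {n : ℕ} (L : PolyLE n 4 →ₗ[ℝ] ℝ) : Prop where
  isPseudoExpectation : IsPseudoExpectation L
  sphere : Satisfies L (spherePoly n)

/-- 3-tensors on `ℝⁿ`, given by their entries. -/
abbrev Tensor3 (n : ℕ) : Type := Fin n × Fin n × Fin n → ℝ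

/-- The law of a 3-tensor with independent standard Gaussian entries. -/
def gaussianTensor (n : ℕ) : Measure (Tensor3 n) :=
  Measure.pi fun _ => gaussianReal 0 1

/-- The cubic form `A(x) = ∑ A_{ijk} x_i x_j x_k`. -/
def tensorPoly {n : ℕ} (A : Tensor3 n) : MvPolynomial (Fin n) ℝ :=
  ∑ i, ∑ j, ∑ k, MvPolynomial.C (A (i, j, k)) *
    (MvPolynomial.X i * MvPolynomial.X j * MvPolynomial.X k)

/-- The linear form `⟨v, x⟩`. -/
def linPoly {n : ℕ} (v : EuclideanSpace ℝ (Fin n)) : MvPolynomial (Fin n) ℝ :=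
  ∑ i, MvPolynomial.C (v i) * MvPolynomial.X i

/-- The tensor PCA objective `t ⟨v, x⟩³ + A(x)`. -/
def objectivePoly {n : ℕ} (t : ℝ) (v : EuclideanSpace ℝ (Fin n)) (A : Tensor3 n) :
    MvPolynomial (Fin n) ℝ :=
  MvPolynomial.C t * linPoly v ^ 3 + tensorPoly A

theorem totalDegree_C_mul_le {n d : ℕ} (a : ℝ) {p : MvPolynomial (Fin n) ℝ}
    (hp : p.totalDegree ≤ d) : (MvPolynomial.C a * p).totalDegree ≤ d := by
  have := MvPolynomial.totalDegree_mul (MvPolynomial.C a) p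
  rw [MvPolynomial.totalDegree_C] at this
  omega

theorem objectivePoly_mem {n : ℕ} (t : ℝ) (v : EuclideanSpace ℝ (Fin n)) (A : Tensor3 n) :
    objectivePoly t v A ∈ PolyLE n 4 := by
  have hX : ∀ i : Fin n, (MvPolynomial.X i : MvPolynomial (Fin n) ℝ).totalDegree ≤ 1 :=
    fun i => (MvPolynomial.totalDegree_X i).le
  have hl : (linPoly v).totalDegree ≤ 1 :=
    MvPolynomial.totalDegree_finsetSum_le fun i _ => totalDegree_C_mul_le _ (hX i)
  have hA : (tensorPoly A).totalDegree ≤ 4 := by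
    refine MvPolynomial.totalDegree_finsetSum_le fun i _ =>
      MvPolynomial.totalDegree_finsetSum_le fun j _ =>
      MvPolynomial.totalDegree_finsetSum_le fun k _ => totalDegree_C_mul_le _ ?_
    have h1 := MvPolynomial.totalDegree_mul
      (MvPolynomial.X i * MvPolynomial.X j : MvPolynomial (Fin n) ℝ) (MvPolynomial.X k)
    have h2 := MvPolynomial.totalDegree_mul
      (MvPolynomial.X i : MvPolynomial (Fin n) ℝ) (MvPolynomial.X j)
    have := hX i
    have := hX j
    have := hX k
    omega
  have hv : (MvPolynomial.C t * linPoly v ^ 3).totalDegree ≤ 4 := by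
    refine totalDegree_C_mul_le _ ?_
    have := MvPolynomial.totalDegree_pow (linPoly v) 3
    omega
  exact (PolyLE n 4).add_mem (mem_polyLE.2 hv) (mem_polyLE.2 hA)

/-- The tensor PCA objective as an element of `ℝ[x]_{≤ 4}`. -/
def objective {n : ℕ} (t : ℝ) (v : EuclideanSpace ℝ (Fin n)) (A : Tensor3 n) : PolyLE n 4 :=
  ⟨objectivePoly t v A, objectivePoly_mem t v A⟩

/-- The value of `L` on the objective `t ⟨v, x⟩³ + A(x)` is maximal up to the factor `r` among all
degree-4 pseudo-distributions satisfying `{‖x‖² = 1}`. -/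
def IsMaximalUpTo {n : ℕ} (r t : ℝ) (v : EuclideanSpace ℝ (Fin n)) (A : Tensor3 n)
    (L : PolyLE n 4 →ₗ[ℝ] ℝ) : Prop :=
  ∀ L' : PolyLE n 4 →ₗ[ℝ] ℝ, IsSpherePseudoDist L' →
    L' (objective t v A) ≤ r * L (objective t v A)

end SoS

end

/-!
Write `S` for the symmetrisation of the noise `A` (the sum over the permutations of the indices, so
that `S(x) = 6 A(x)`) and `S_k` for its slices. Everything is governed by the matrix
`∑ k, S_k ⊗ S_k` on `ℝⁿ ⊗ ℝⁿ`, called `sqFlat S`: up to logarithms, both the largest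
pseudo-expectation of `A(x)` and the value that a pseudo-distribution built from `A` alone achieves
are `n^{3/4}`. With `τ(n) = n^{3/4}` the spike is of the same order and cannot upset the comparison.

*The noise.* `E sqFlat S = 6 (n + 2) (swap + I Iᵀ)`, where `I` is the identity as a vector, and
the deviation `centredFlat A` has operator norm `O(n^{3/2} log n)` with probability `1 - 2 n^{-10}`
(`gaussianTensor_centredFlat_le`). Hence `|⟨Y, sqFlat S Y⟩| ≤ N (‖Y‖² + (tr Y)²)` with `N` of order
`n^{3/2} log n`; this is the predicate `FormBound S N`. The norm is bounded by trace moments.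
The entries of `X = centredFlat A` are eigenfunctions of eigenvalue `2` of the Ornstein–Uhlenbeck
operator, so Gaussian integration by parts gives
`2 E tr X^{2q+2} = E ∑ a, ∑ j, tr (∂_a X · X^j · ∂_a X · X^{2q-j})`, and diagonalising `X` shows
that each summand is at most `tr ((∂_a X)² X^{2q})` (`GaussianPoly.integral_trace_pow_le`). The
derivative is linear in `S`, and its size `∑ a, ‖∂_a X y‖²` is controlled by `sqFlat S` itself, that
is, by `n³ + n^{3/2} ‖X‖` (`sum_sq_derivative_le`). Since `‖X‖ tr X^{2q}` is at most a multiple of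
`∑ |λ|^{2q+1}` once `q` exceeds `log n`, the resulting inequality bounds the moment by itself and
closes up.

*Lower bound.* The functional with fourth moments those of the uniform distribution on the sphere
plus a multiple of the symmetrisation of `∑ r, S_r ⊗ S_r`, and third moments a multiple of `S`, is a
pseudo-distribution as soon as `FormBound S N` holds: on `p = ⟨u, x⟩ + ⟨x, M x⟩` the term
`∑ r, ⟨S_r, M⟩²` absorbs the odd moments, and the uniform part outweighs the other two pairings
(`isSpherePseudoDist_tensorFunctional`). Its value on `A(x)` is at least of order
`‖S‖² / (n^{3/2} √N)`, where `‖S‖² ≥ 3 n³` by evaluating `sqFlat S` at `I`, while the spike changes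
it by at most `τ(n) √(2 N)` times the same normalisation, which is negligible.

*Upper bound.* For an arbitrary pseudo-distribution `E'` on the sphere, Cauchy–Schwarz gives
`(E' S(x))² ≤ ∑ k, E' ⟨x, S_k x⟩²`, and the right side is at most `2 N` because
`N (1 + I Iᵀ) - sqFlat S` is positive semidefinite, hence a sum of squares
(`IsSphereFunctional.map_cubic_le`). Also `E' ⟨v, x⟩³ ≤ 1` for unit `v`
(`IsSphereFunctional.map_linForm_pow_three_le`). The two bounds are compared in
`IsTypical.isMaximalUpTo`.
-/

/-! ### Polynomials in Gaussian variables -/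

namespace GaussianPoly

open MvPolynomial

theorem integrable_pow_gaussianReal (m : ℕ) :
    Integrable (fun x : ℝ => x ^ m) (gaussianReal 0 1) := by
  have h := (memLp_id_gaussianReal (μ := 0) (v := 1) (m : NNReal)).integrable_norm_pow' (p := m)
  refine (integrable_norm_iff (by fun_prop)).1 ?_
  simpa using h

theorem integrable_pow_mul_gaussianPDFReal (m : ℕ) :
    Integrable (fun x : ℝ => x ^ m * gaussianPDFReal 0 1 x) := by
  have h := integrable_pow_gaussianReal m
  rw [gaussianReal_of_var_ne_zero 0 one_ne_zero,
    integrable_withDensity_iff (measurable_gaussianPDF 0 1) (by simp [gaussianPDF_lt_top])] at h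
  simpa [toReal_gaussianPDF] using h

theorem hasDerivAt_gaussianPDFReal (x : ℝ) :
    HasDerivAt (gaussianPDFReal 0 1) (-x * gaussianPDFReal 0 1 x) x := by
  have h1 : HasDerivAt (fun y : ℝ => -(y - 0) ^ 2 / (2 * ((1 : NNReal) : ℝ))) (-x) x := by
    have := (((hasDerivAt_id x).sub_const 0).pow 2).neg.div_const (2 * ((1 : NNReal) : ℝ))
    refine this.congr_deriv ?_
    simp [neg_div]
  have h2 := (h1.exp).const_mul (√(2 * Real.pi * ((1 : NNReal) : ℝ)))⁻¹
  rw [gaussianPDFReal_def]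
  refine h2.congr_deriv ?_
  ring

/-- Stein's identity for monomials in one Gaussian variable. -/
theorem integral_mul_pow_gaussianReal (m : ℕ) :
    ∫ x, x * x ^ m ∂gaussianReal 0 1 = m * ∫ x, x ^ (m - 1) ∂gaussianReal 0 1 := by
  rw [integral_gaussianReal_eq_integral_smul one_ne_zero,
    integral_gaussianReal_eq_integral_smul one_ne_zero, ← integral_const_mul]
  have h := integral_mul_deriv_eq_deriv_mul_of_integrable
    (u := fun x : ℝ => x ^ m) (v := gaussianPDFReal 0 1)
    (u' := fun x : ℝ => m * x ^ (m - 1)) (v' := fun x => -x * gaussianPDFReal 0 1 x)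
    (fun x _ => by simpa using hasDerivAt_pow m x) (fun x _ => hasDerivAt_gaussianPDFReal x)
    (by
      refine (integrable_pow_mul_gaussianPDFReal (m + 1)).neg.congr (ae_of_all _ fun x => ?_)
      simp [pow_succ]; ring)
    (by
      refine ((integrable_pow_mul_gaussianPDFReal (m - 1)).const_mul (m : ℝ)).congr
        (ae_of_all _ fun x => ?_)
      simp; ring)
    (by simpa [Pi.mul_def] using integrable_pow_mul_gaussianPDFReal m)
  simp only [smul_eq_mul]
  rw [← neg_inj, ← integral_neg, ← integral_neg]
  rw [← integral_neg] at h
  convert h using 1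
  · congr 1; ext x; ring
  · congr 1; ext x; ring

variable {ι : Type*} [Fintype ι]

theorem eval_monomial_eq_prod (g : ι → ℝ) (m : ι →₀ ℕ) (c : ℝ) :
    eval g (monomial m c) = c * ∏ i, g i ^ m i := by
  rw [eval_monomial, Finsupp.prod_fintype _ _ (by simp)]

theorem integrable_eval (P : MvPolynomial ι ℝ) :
    Integrable (fun g : ι → ℝ => eval g P) (Measure.pi fun _ => gaussianReal 0 1) := by
  induction P using MvPolynomial.induction_on' with
  | monomial m c =>
    simp only [eval_monomial_eq_prod]
    exact (Integrable.fintype_prod (f := fun i x => x ^ m i)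
      fun i => integrable_pow_gaussianReal (m i)).const_mul c
  | add p q hp hq => simp only [map_add]; exact hp.add hq

/-- Gaussian integration by parts for polynomials. -/
theorem integral_mul_eval (P : MvPolynomial ι ℝ) (a : ι) :
    ∫ g : ι → ℝ, eval g (X a * P) ∂(Measure.pi fun _ => gaussianReal 0 1) =
      ∫ g : ι → ℝ, eval g (pderiv a P) ∂(Measure.pi fun _ => gaussianReal 0 1) := by
  classical
  induction P using MvPolynomial.induction_on' with
  | monomial m c =>
    rw [pderiv_monomial]
    simp only [map_mul, eval_X, eval_monomial_eq_prod]
    have h1 : ∀ g : ι → ℝ, g a * (c * ∏ i, g i ^ m i) =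
        c * ∏ i, (if i = a then g i * g i ^ m i else g i ^ m i) := by
      intro g
      rw [← Finset.mul_prod_erase _ _ (Finset.mem_univ a),
        ← Finset.mul_prod_erase _ _ (Finset.mem_univ a), if_pos rfl,
        Finset.prod_congr (g := fun i => g i ^ m i) rfl
          fun i hi => if_neg (Finset.ne_of_mem_erase hi)]
      ring
    simp only [h1, integral_const_mul]
    have e1 := integral_fintype_prod_eq_prod (μ := fun _ : ι => gaussianReal 0 1)
      (fun i (x : ℝ) => if i = a then x * x ^ m i else x ^ m i)
    have e2 := integral_fintype_prod_eq_prod (μ := fun _ : ι => gaussianReal 0 1)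
      (fun i (x : ℝ) => x ^ ((m - Finsupp.single a 1 : ι →₀ ℕ) i))
    rw [e1, e2, ← Finset.mul_prod_erase _ _ (Finset.mem_univ a),
      ← Finset.mul_prod_erase _ _ (Finset.mem_univ a)]
    simp only [if_true, integral_mul_pow_gaussianReal]
    have h3 : ∀ i ∈ Finset.univ.erase a,
        (∫ x : ℝ, (if i = a then x * x ^ m i else x ^ m i) ∂gaussianReal 0 1) =
        ∫ x : ℝ, x ^ ((m - Finsupp.single a 1 : ι →₀ ℕ) i) ∂gaussianReal 0 1 := by
      intro i hi
      have := Finset.ne_of_mem_erase hi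
      simp [this]
    rw [Finset.prod_congr rfl h3]
    simp
    ring
  | add p q hp hq =>
    simp only [mul_add, map_add]
    rw [integral_add (integrable_eval _) (integrable_eval _),
      integral_add (integrable_eval _) (integrable_eval _)]
    rw [hp, hq]

end GaussianPoly

/-! ### Trace inequalities for symmetric matrices -/

namespace SymmMatrix

open Matrix

variable {κ : Type*} [Fintype κ]

theorem exists_diagonalization [DecidableEq κ] {X : Matrix κ κ ℝ} (hX : X.IsSymm) :
    ∃ (l : κ → ℝ) (U : Matrix κ κ ℝ), Uᵀ * U = 1 ∧ U * Uᵀ = 1 ∧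
      ∀ m : ℕ, X ^ m = U * diagonal (fun i => l i ^ m) * Uᵀ := by
  have hH : X.IsHermitian := by
    rw [IsHermitian, conjTranspose_eq_transpose_of_trivial]; exact hX
  have hU := hH.eigenvectorUnitary.2
  rw [mem_unitaryGroup_iff, star_eq_conjTranspose, conjTranspose_eq_transpose_of_trivial] at hU
  have hU' := mul_eq_one_comm.1 hU
  refine ⟨hH.eigenvalues, hH.eigenvectorUnitary.1, hU', hU, fun m => ?_⟩
  have hs := hH.spectral_theorem
  rw [Unitary.conjStarAlgAut_apply, star_eq_conjTranspose,
    conjTranspose_eq_transpose_of_trivial] at hs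
  set U : Matrix κ κ ℝ := hH.eigenvectorUnitary.1
  have hc : (RCLike.ofReal ∘ hH.eigenvalues : κ → ℝ) = hH.eigenvalues := by ext; simp
  rw [hc] at hs
  generalize hH.eigenvalues = l at hs
  induction m with
  | zero => simp [hU]
  | succ m ih =>
    rw [pow_succ, ih]
    rw [hs]
    have : U * diagonal (fun i => l i ^ m) * Uᵀ * (U * diagonal l * Uᵀ) =
        U * diagonal (fun i => l i ^ m) * (Uᵀ * U) * diagonal l * Uᵀ := by
      simp only [Matrix.mul_assoc]
    rw [this, hU', Matrix.mul_one, Matrix.mul_assoc U, diagonal_mul_diagonal]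
    simp only [pow_succ]

theorem trace_conj [DecidableEq κ] {U : Matrix κ κ ℝ} (hU : Uᵀ * U = 1) (E : Matrix κ κ ℝ) :
    (U * E * Uᵀ).trace = E.trace := by
  rw [trace_mul_comm, ← Matrix.mul_assoc, hU, Matrix.one_mul]

theorem pow_mul_pow_add_le (x y : ℝ) {j k q : ℕ} (h : j + k = 2 * q) :
    x ^ j * y ^ k + y ^ j * x ^ k ≤ x ^ (2 * q) + y ^ (2 * q) := by
  have key : ∀ a b : ℝ, 0 ≤ a → 0 ≤ b →
      a ^ j * b ^ k + b ^ j * a ^ k ≤ a ^ (j + k) + b ^ (j + k) := by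
    intro a b ha hb
    have : 0 ≤ (a ^ j - b ^ j) * (a ^ k - b ^ k) := by
      rcases le_total a b with hab | hab
      · exact mul_nonneg_of_nonpos_of_nonpos (sub_nonpos.2 (pow_le_pow_left₀ ha hab j))
          (sub_nonpos.2 (pow_le_pow_left₀ ha hab k))
      · exact mul_nonneg (sub_nonneg.2 (pow_le_pow_left₀ hb hab j))
          (sub_nonneg.2 (pow_le_pow_left₀ hb hab k))
    rw [pow_add, pow_add]
    nlinarith
  have h1 := key |x| |y| (abs_nonneg x) (abs_nonneg y)
  rw [h, pow_mul |x|, pow_mul |y|, sq_abs, sq_abs, ← pow_mul, ← pow_mul] at h1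
  refine le_trans (add_le_add ?_ ?_) h1
  · rw [← abs_pow, ← abs_pow, ← abs_mul]; exact le_abs_self _
  · rw [← abs_pow, ← abs_pow, ← abs_mul]; exact le_abs_self _

/-- Moving the powers of `X` together increases the trace: in an eigenbasis of `X` this is
`x ^ j * y ^ k + y ^ j * x ^ k ≤ x ^ (j + k) + y ^ (j + k)` for each pair of eigenvalues. -/
theorem trace_mul_pow_mul_mul_pow_le [DecidableEq κ] {D X : Matrix κ κ ℝ} (hD : D.IsSymm)
    (hX : X.IsSymm) {j k q : ℕ} (h : j + k = 2 * q) :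
    (D * X ^ j * D * X ^ k).trace ≤ (D * D * X ^ (2 * q)).trace := by
  obtain ⟨l, U, hU, hU', hp⟩ := exists_diagonalization hX
  set E := Uᵀ * D * U with hE
  have hEs : ∀ r s, E r s = E s r := by
    have : Eᵀ = E := by simp [hE, Matrix.mul_assoc, hD.eq]
    intro r s; exact congrFun (congrFun this s) r |>.symm ▸ rfl
  have hDE : D = U * E * Uᵀ := by
    rw [hE]
    calc D = (U * Uᵀ) * D * (U * Uᵀ) := by rw [hU']; simp
      _ = _ := by simp only [Matrix.mul_assoc]
  have e1 : D * X ^ j * D * X ^ k =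
      U * (E * diagonal (fun i => l i ^ j) * E * diagonal (fun i => l i ^ k)) * Uᵀ := by
    rw [hp j, hp k]
    rw [hDE]
    calc _ = U * E * (Uᵀ * U) * diagonal (fun i => l i ^ j) * (Uᵀ * U) * E * (Uᵀ * U) *
          diagonal (fun i => l i ^ k) * Uᵀ := by simp only [Matrix.mul_assoc]
      _ = _ := by simp only [hU, Matrix.mul_one]; simp only [Matrix.mul_assoc]
  have e2 : D * D * X ^ (2 * q) = U * (E * E * diagonal (fun i => l i ^ (2 * q))) * Uᵀ := by
    rw [hp (2 * q)]
    rw [hDE]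
    calc _ = U * E * (Uᵀ * U) * E * (Uᵀ * U) *
          diagonal (fun i => l i ^ (2 * q)) * Uᵀ := by simp only [Matrix.mul_assoc]
      _ = _ := by simp only [hU, Matrix.mul_one]; simp only [Matrix.mul_assoc]
  rw [e1, e2, trace_conj hU, trace_conj hU]
  have f1 : (E * diagonal (fun i => l i ^ j) * E * diagonal (fun i => l i ^ k)).trace =
      ∑ r, ∑ s, E r s ^ 2 * (l s ^ j * l r ^ k) := by
    simp only [trace, diag_apply, mul_diagonal]
    refine Finset.sum_congr rfl fun r _ => ?_
    rw [mul_apply, Finset.sum_mul]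
    refine Finset.sum_congr rfl fun s _ => ?_
    simp only [mul_diagonal]
    rw [hEs s r]; ring
  have f2 : (E * E * diagonal (fun i => l i ^ (2 * q))).trace =
      ∑ r, ∑ s, E r s ^ 2 * l r ^ (2 * q) := by
    simp only [trace, diag_apply, mul_diagonal]
    refine Finset.sum_congr rfl fun r _ => ?_
    rw [mul_apply, Finset.sum_mul]
    refine Finset.sum_congr rfl fun s _ => ?_
    rw [hEs s r]; ring
  rw [f1, f2]
  have g1 : ∑ r, ∑ s, E r s ^ 2 * (l s ^ j * l r ^ k) =
      ∑ r, ∑ s, E r s ^ 2 * (l r ^ j * l s ^ k) := by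
    rw [Finset.sum_comm]
    refine Finset.sum_congr rfl fun r _ => Finset.sum_congr rfl fun s _ => ?_
    rw [hEs s r]
  have g2 : ∑ r, ∑ s, E r s ^ 2 * l r ^ (2 * q) = ∑ r, ∑ s, E r s ^ 2 * l s ^ (2 * q) := by
    rw [Finset.sum_comm]
    refine Finset.sum_congr rfl fun r _ => Finset.sum_congr rfl fun s _ => ?_
    rw [hEs s r]
  have : ∑ r, ∑ s, E r s ^ 2 * (l s ^ j * l r ^ k) + ∑ r, ∑ s, E r s ^ 2 * (l r ^ j * l s ^ k) ≤
      ∑ r, ∑ s, E r s ^ 2 * l r ^ (2 * q) + ∑ r, ∑ s, E r s ^ 2 * l s ^ (2 * q) := by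
    simp only [← Finset.sum_add_distrib, ← mul_add]
    refine Finset.sum_le_sum fun r _ => Finset.sum_le_sum fun s _ => ?_
    have := pow_mul_pow_add_le (l r) (l s) h
    exact mul_le_mul_of_nonneg_left (by linarith) (sq_nonneg _)
  linarith

theorem trace_transpose_mul_self_eq (Y : Matrix κ κ ℝ) :
    (Yᵀ * Y).trace = ∑ c, (fun r => Y r c) ⬝ᵥ (fun r => Y r c) := by
  simp [trace, mul_apply, dotProduct]

/-- If `∑ a, ‖D a y‖² ≤ v ‖y‖²` for all `y`, then `tr ((∑ a, D a ²) X^{2q}) ≤ v tr X^{2q}`. -/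
theorem sum_trace_sq_mul_pow_le [DecidableEq κ] {ι : Type*} [Fintype ι] {D : ι → Matrix κ κ ℝ}
    (hD : ∀ a, (D a).IsSymm) {X : Matrix κ κ ℝ} (hX : X.IsSymm) {v : ℝ}
    (hv : ∀ y : κ → ℝ, ∑ a, (D a *ᵥ y) ⬝ᵥ (D a *ᵥ y) ≤ v * (y ⬝ᵥ y)) (q : ℕ) :
    ∑ a, (D a * D a * X ^ (2 * q)).trace ≤ v * (X ^ (2 * q)).trace := by
  have hXq : (X ^ q)ᵀ = X ^ q := by rw [transpose_pow, hX.eq]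
  have h1 : ∀ a, (D a * D a * X ^ (2 * q)).trace = ((D a * X ^ q)ᵀ * (D a * X ^ q)).trace := by
    intro a
    rw [transpose_mul, hXq, (hD a).eq, two_mul, pow_add, ← Matrix.mul_assoc, trace_mul_comm]
    simp only [Matrix.mul_assoc]
  have h2 : (X ^ (2 * q)).trace = ((X ^ q)ᵀ * (X ^ q)).trace := by
    rw [hXq, two_mul, pow_add]
  simp only [h1, h2, trace_transpose_mul_self_eq]
  rw [Finset.sum_comm, Finset.mul_sum]
  refine Finset.sum_le_sum fun c _ => ?_
  simpa [mulVec, dotProduct, mul_apply] using hv fun r => (X ^ q) r c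

theorem dotProduct_sq_le (y z : κ → ℝ) : (y ⬝ᵥ z) ^ 2 ≤ (y ⬝ᵥ y) * (z ⬝ᵥ z) := by
  simpa [dotProduct, sq] using Finset.sum_mul_sq_le_sq_mul_sq Finset.univ y z

theorem dotProduct_mulVec_sq_le_of_diagonalization [DecidableEq κ] {l : κ → ℝ} {U X : Matrix κ κ ℝ}
    (hU : Uᵀ * U = 1) (hU' : U * Uᵀ = 1) (hX : X = U * diagonal l * Uᵀ) {s : ℝ}
    (hs : ∀ i, l i ^ 2 ≤ s) (y z : κ → ℝ) :
    (y ⬝ᵥ X *ᵥ z) ^ 2 ≤ s * ((y ⬝ᵥ y) * (z ⬝ᵥ z)) := by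
  have hz : (Uᵀ *ᵥ z) ⬝ᵥ (Uᵀ *ᵥ z) = z ⬝ᵥ z := by
    rw [dotProduct_mulVec, vecMul_transpose, mulVec_mulVec, hU', one_mulVec]
  set w := Uᵀ *ᵥ z
  have hXz : X *ᵥ z = U *ᵥ (diagonal l *ᵥ w) := by
    simp [hX, w, mulVec_mulVec, Matrix.mul_assoc]
  have hn : (X *ᵥ z) ⬝ᵥ (X *ᵥ z) = (diagonal l *ᵥ w) ⬝ᵥ (diagonal l *ᵥ w) := by
    rw [hXz, dotProduct_mulVec, ← mulVec_transpose, mulVec_mulVec, hU, one_mulVec]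
  have hle : (X *ᵥ z) ⬝ᵥ (X *ᵥ z) ≤ s * (z ⬝ᵥ z) := by
    rw [hn, ← hz]
    simp only [dotProduct, mulVec_diagonal, Finset.mul_sum]
    refine Finset.sum_le_sum fun i _ => ?_
    nlinarith [mul_le_mul_of_nonneg_right (hs i) (sq_nonneg (w i))]
  have hyy : 0 ≤ y ⬝ᵥ y := by
    simpa using dotProduct_star_self_nonneg y
  calc _ ≤ (y ⬝ᵥ y) * ((X *ᵥ z) ⬝ᵥ (X *ᵥ z)) := dotProduct_sq_le _ _
    _ ≤ (y ⬝ᵥ y) * (s * (z ⬝ᵥ z)) := mul_le_mul_of_nonneg_left hle hyy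
    _ = _ := by ring

theorem trace_pow_of_diagonalization [DecidableEq κ] {l : κ → ℝ} {U X : Matrix κ κ ℝ}
    (hU : Uᵀ * U = 1) (hp : ∀ m : ℕ, X ^ m = U * diagonal (fun i => l i ^ m) * Uᵀ) (m : ℕ) :
    (X ^ m).trace = ∑ i, l i ^ m := by
  rw [hp, trace_conj hU]; simp [trace]

theorem trace_pow_nonneg [DecidableEq κ] {X : Matrix κ κ ℝ} (hX : X.IsSymm) (q : ℕ) :
    0 ≤ (X ^ (2 * q)).trace := by
  obtain ⟨l, U, hU, hU', hp⟩ := exists_diagonalization hX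
  rw [trace_pow_of_diagonalization hU hp]
  exact Finset.sum_nonneg fun i _ => by rw [pow_mul]; positivity

/-- A bound on `tr X^{2p}` bounds the operator norm of `X`. -/
theorem dotProduct_mulVec_sq_le_of_trace [DecidableEq κ] {X : Matrix κ κ ℝ} (hX : X.IsSymm)
    {p : ℕ} (hp0 : p ≠ 0) {b : ℝ} (htr : (X ^ (2 * p)).trace ≤ b ^ (2 * p)) (y z : κ → ℝ) :
    (y ⬝ᵥ X *ᵥ z) ^ 2 ≤ b ^ 2 * ((y ⬝ᵥ y) * (z ⬝ᵥ z)) := by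
  obtain ⟨l, U, hU, hU', hp⟩ := exists_diagonalization hX
  refine dotProduct_mulVec_sq_le_of_diagonalization hU hU' (by simpa using hp 1) (fun i => ?_) y z
  rw [trace_pow_of_diagonalization hU hp] at htr
  have h1 : l i ^ (2 * p) ≤ b ^ (2 * p) :=
    (Finset.single_le_sum (f := fun i => l i ^ (2 * p))
      (fun i _ => by rw [pow_mul]; positivity) (Finset.mem_univ i)).trans htr
  rw [pow_mul, pow_mul] at h1
  exact le_of_pow_le_pow_left₀ hp0 (by positivity) h1

theorem sq_mul_pow_le (α x : ℝ) (q : ℕ) :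
    α ^ 2 * x ^ (2 * q) ≤ x ^ (2 * q + 2) / 4 + (2 * α) ^ (2 * q + 2) := by
  have hx : 0 ≤ x ^ (2 * q) := by rw [pow_mul]; positivity
  have hα : 0 ≤ (2 * α) ^ (2 * q + 2) := by
    rw [← Nat.mul_succ, pow_mul]; positivity
  rcases le_total ((2 * α) ^ 2) (x ^ 2) with h | h
  · rw [pow_add]
    nlinarith [mul_le_mul_of_nonneg_right h hx]
  · have h1 : x ^ (2 * q) ≤ (2 * α) ^ (2 * q) := by
      rw [pow_mul, pow_mul]; exact pow_le_pow_left₀ (sq_nonneg x) h q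
    have h2 : 0 ≤ x ^ (2 * q + 2) := by rw [← Nat.mul_succ, pow_mul]; positivity
    rw [pow_add (2 * α)]
    nlinarith [mul_le_mul_of_nonneg_right h1 (sq_nonneg α), sq_nonneg α]

theorem mul_abs_pow_le {α : ℝ} (hα : 0 ≤ α) (x : ℝ) (q : ℕ) :
    4 * α * |x| ^ (2 * q + 1) ≤ x ^ (2 * q + 2) / 4 + (16 * α) ^ (2 * q + 2) := by
  have hx : x ^ (2 * q + 2) = |x| ^ (2 * q + 2) := by
    rw [← Nat.mul_succ, pow_mul, pow_mul, sq_abs]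
  rw [hx]
  have h0 := abs_nonneg x
  generalize |x| = t at *
  rcases le_total (16 * α) t with h | h
  · rw [pow_succ t (2 * q + 1)]
    have : 0 ≤ (16 * α) ^ (2 * q + 2) := by positivity
    nlinarith [mul_le_mul_of_nonneg_left h (pow_nonneg h0 (2 * q + 1))]
  · have h1 : t ^ (2 * q + 1) ≤ (16 * α) ^ (2 * q + 1) := pow_le_pow_left₀ h0 h _
    have h2 : 0 ≤ t ^ (2 * q + 2) := by positivity
    rw [pow_succ (16 * α) (2 * q + 1)]
    have h3 : 0 ≤ (16 * α) ^ (2 * q + 1) := by positivity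
    nlinarith [mul_le_mul_of_nonneg_left h1 hα]

/-- If `3^{2q}` is at least the number of eigenvalues, the eigenvalues that are smaller than a third
of `|l i₀|` are negligible in `∑ |l i|^{2q+1}`. -/
theorem mul_sum_pow_le {l : κ → ℝ} (i₀ : κ) {q : ℕ}
    (hq : (Fintype.card κ : ℝ) ≤ 3 ^ (2 * q)) :
    |l i₀| * ∑ i, l i ^ (2 * q) ≤ 4 * ∑ i, |l i| ^ (2 * q + 1) := by
  set μ := |l i₀|
  have hμ : 0 ≤ μ := abs_nonneg _
  have h1 : ∀ i, μ * l i ^ (2 * q) ≤ 3 * |l i| ^ (2 * q + 1) + μ * (μ / 3) ^ (2 * q) := by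
    intro i
    have hl : l i ^ (2 * q) = |l i| ^ (2 * q) := by rw [pow_mul, pow_mul, sq_abs]
    rw [hl]
    have h0 := abs_nonneg (l i)
    rcases le_total (μ / 3) |l i| with h | h
    · have : 0 ≤ μ * (μ / 3) ^ (2 * q) := by positivity
      rw [pow_succ]
      nlinarith [mul_le_mul_of_nonneg_left h (pow_nonneg h0 (2 * q))]
    · have := mul_le_mul_of_nonneg_left (pow_le_pow_left₀ h0 h (2 * q)) hμ
      have h2 : 0 ≤ 3 * |l i| ^ (2 * q + 1) := by positivity
      linarith
  have h2 : (Fintype.card κ : ℝ) * (μ * (μ / 3) ^ (2 * q)) ≤ ∑ i, |l i| ^ (2 * q + 1) := by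
    calc (Fintype.card κ : ℝ) * (μ * (μ / 3) ^ (2 * q))
        ≤ 3 ^ (2 * q) * (μ * (μ / 3) ^ (2 * q)) :=
          mul_le_mul_of_nonneg_right hq (by positivity)
      _ = μ ^ (2 * q + 1) := by rw [div_pow, pow_succ]; field_simp
      _ ≤ _ := Finset.single_le_sum (f := fun i => |l i| ^ (2 * q + 1))
          (fun i _ => by positivity) (Finset.mem_univ i₀)
  calc μ * ∑ i, l i ^ (2 * q) ≤ ∑ i, (3 * |l i| ^ (2 * q + 1) + μ * (μ / 3) ^ (2 * q)) := by
        rw [Finset.mul_sum]; exact Finset.sum_le_sum fun i _ => h1 i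
    _ = 3 * ∑ i, |l i| ^ (2 * q + 1) + (Fintype.card κ : ℝ) * (μ * (μ / 3) ^ (2 * q)) := by
        rw [Finset.sum_add_distrib, ← Finset.mul_sum]; simp
    _ ≤ _ := by linarith

/-- The number `μ` is the operator norm of `X`. The bound on `(α² + α μ) tr X^{2q}` leaves half of
`tr X^{2q+2}`, so that it can be moved to the other side of an inequality for that trace. -/
theorem exists_opNorm_bound [DecidableEq κ] [Nonempty κ] {X : Matrix κ κ ℝ} (hX : X.IsSymm)
    {α : ℝ} (hα : 0 ≤ α) {q : ℕ} (hq : (Fintype.card κ : ℝ) ≤ 3 ^ (2 * q)) :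
    ∃ μ : ℝ, 0 ≤ μ ∧ (∀ y z : κ → ℝ, (y ⬝ᵥ X *ᵥ z) ^ 2 ≤ μ ^ 2 * ((y ⬝ᵥ y) * (z ⬝ᵥ z))) ∧
      (α ^ 2 + α * μ) * (X ^ (2 * q)).trace ≤
        (X ^ (2 * q + 2)).trace / 2 + 2 * (Fintype.card κ * (16 * α) ^ (2 * q + 2)) := by
  obtain ⟨l, U, hU, hU', hp⟩ := exists_diagonalization hX
  obtain ⟨i₀, -, hi₀⟩ := Finset.exists_max_image Finset.univ (fun i => |l i|) Finset.univ_nonempty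
  refine ⟨|l i₀|, abs_nonneg _, fun y z => ?_, ?_⟩
  · refine dotProduct_mulVec_sq_le_of_diagonalization hU hU' (by simpa using hp 1) (fun i => ?_) y z
    exact sq_le_sq' (by linarith [hi₀ i (Finset.mem_univ i), neg_abs_le (l i)])
      ((le_abs_self _).trans (hi₀ i (Finset.mem_univ i)))
  · rw [trace_pow_of_diagonalization hU hp, trace_pow_of_diagonalization hU hp]
    have h1 := mul_sum_pow_le (l := l) i₀ hq
    have h2 : α ^ 2 * ∑ i, l i ^ (2 * q) ≤
        (∑ i, l i ^ (2 * q + 2)) / 4 + Fintype.card κ * (16 * α) ^ (2 * q + 2) := by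
      have : (2 * α) ^ (2 * q + 2) ≤ (16 * α) ^ (2 * q + 2) :=
        pow_le_pow_left₀ (by positivity) (by linarith) _
      calc _ ≤ ∑ i, (l i ^ (2 * q + 2) / 4 + (16 * α) ^ (2 * q + 2)) := by
            rw [Finset.mul_sum]
            exact Finset.sum_le_sum fun i _ => (sq_mul_pow_le α (l i) q).trans (by linarith)
        _ = _ := by rw [Finset.sum_add_distrib, ← Finset.sum_div]; simp
    have h3 : α * (4 * ∑ i, |l i| ^ (2 * q + 1)) ≤
        (∑ i, l i ^ (2 * q + 2)) / 4 + Fintype.card κ * (16 * α) ^ (2 * q + 2) := by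
      calc _ = ∑ i, 4 * α * |l i| ^ (2 * q + 1) := by rw [← Finset.mul_sum]; ring
        _ ≤ ∑ i, (l i ^ (2 * q + 2) / 4 + (16 * α) ^ (2 * q + 2)) :=
            Finset.sum_le_sum fun i _ => mul_abs_pow_le hα (l i) q
        _ = _ := by rw [Finset.sum_add_distrib, ← Finset.sum_div]; simp
    have h4 := mul_le_mul_of_nonneg_left h1 hα
    linarith

end SymmMatrix

/-! ### Trace moments of random matrices with polynomial entries -/

namespace GaussianPoly

open MvPolynomial
open scoped Matrix

variable {ι κ : Type*} [Fintype κ]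

theorem map_pderiv_mul (a : ι) (M N : Matrix κ κ (MvPolynomial ι ℝ)) :
    (M * N).map (pderiv a) = M.map (pderiv a) * N + M * N.map (pderiv a) := by
  ext i j : 1
  simp only [Matrix.map_apply, Matrix.mul_apply, Matrix.add_apply, map_sum, pderiv_mul,
    Finset.sum_add_distrib]

theorem map_pderiv_pow [DecidableEq κ] (a : ι) (M : Matrix κ κ (MvPolynomial ι ℝ)) (m : ℕ) :
    (M ^ m).map (pderiv a) =
      ∑ j ∈ Finset.range m, M ^ j * M.map (pderiv a) * M ^ (m - 1 - j) := by
  induction m with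
  | zero =>
    ext i j : 1
    by_cases h : i = j <;> simp [h]
  | succ m ih =>
    rw [pow_succ, map_pderiv_mul, ih, Finset.sum_range_succ, Finset.sum_mul]
    refine congrArg₂ (· + ·) ?_ ?_
    · refine Finset.sum_congr rfl fun j hj => ?_
      have := Finset.mem_range.1 hj
      rw [Matrix.mul_assoc, ← pow_succ, show m - 1 - j + 1 = m + 1 - 1 - j by omega]
    · simp

theorem pderiv_trace (a : ι) (M : Matrix κ κ (MvPolynomial ι ℝ)) :
    pderiv a M.trace = (M.map (pderiv a)).trace := by
  simp [Matrix.trace]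

theorem eval_trace [DecidableEq κ] (g : ι → ℝ) (M : Matrix κ κ (MvPolynomial ι ℝ)) :
    eval g M.trace = ((eval g).mapMatrix M).trace := by
  simp [Matrix.trace]

/-- Trace moments of a random symmetric matrix `M`, each entry of which is an eigenfunction of the
Ornstein–Uhlenbeck operator `∑ a, (x_a ∂_a - ∂_a²)` of eigenvalue `2` (a centred quadratic form in
Gaussian variables). Integration by parts moves one factor of `M` onto the others, and
`SymmMatrix.trace_mul_pow_mul_mul_pow_le` gathers the two derivatives. -/
theorem integral_trace_pow_le [Fintype ι] [DecidableEq κ] {M : Matrix κ κ (MvPolynomial ι ℝ)}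
    (hM : M.IsSymm)
    (hOU : ∀ r c, ∑ a, (X a * pderiv a (M r c) - pderiv a (pderiv a (M r c))) = 2 * M r c)
    (q : ℕ) :
    2 * ∫ g : ι → ℝ, ((eval g).mapMatrix M ^ (2 * q + 2)).trace
        ∂(Measure.pi fun _ => gaussianReal 0 1) ≤
      ∫ g : ι → ℝ, (2 * q + 1) * ∑ a, ((eval g).mapMatrix (M.map (pderiv a)) *
        (eval g).mapMatrix (M.map (pderiv a)) * (eval g).mapMatrix M ^ (2 * q)).trace
        ∂(Measure.pi fun _ => gaussianReal 0 1) := by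
  set γ : Measure (ι → ℝ) := Measure.pi fun _ => gaussianReal 0 1
  set D : ι → Matrix κ κ (MvPolynomial ι ℝ) := fun a => M.map (pderiv a) with hDdef
  have hDs : ∀ a, (D a).IsSymm := fun a => hM.map _
  have hcomm : ∀ g : ι → ℝ, ((eval g).mapMatrix M).IsSymm := fun g => hM.map _
  have hcommD : ∀ (g : ι → ℝ) a, ((eval g).mapMatrix (D a)).IsSymm := fun g a => (hDs a).map _
  have key : 2 * (M ^ (2 * q + 2)).trace = ∑ a, (X a * (D a * M ^ (2 * q + 1)).trace -
      ((D a).map (pderiv a) * M ^ (2 * q + 1)).trace) := by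
    have h1 : ∀ a, X a * (D a * M ^ (2 * q + 1)).trace -
        ((D a).map (pderiv a) * M ^ (2 * q + 1)).trace =
        ∑ r, ∑ c, (X a * pderiv a (M r c) - pderiv a (pderiv a (M r c))) *
          (M ^ (2 * q + 1)) c r := by
      intro a
      simp only [Matrix.trace, Matrix.diag_apply, Matrix.mul_apply, Finset.mul_sum,
        ← Finset.sum_sub_distrib, hDdef, Matrix.map_apply]
      exact Finset.sum_congr rfl fun r _ => Finset.sum_congr rfl fun c _ => by ring
    simp only [h1]
    rw [Finset.sum_comm]
    have h2 : ∀ r, ∑ a, ∑ c, (X a * pderiv a (M r c) - pderiv a (pderiv a (M r c))) *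
        (M ^ (2 * q + 1)) c r = ∑ c, 2 * M r c * (M ^ (2 * q + 1)) c r := by
      intro r
      rw [Finset.sum_comm]
      simp only [← Finset.sum_mul, hOU]
    simp only [h2]
    rw [show 2 * q + 2 = (2 * q + 1) + 1 by ring, pow_succ' M (2 * q + 1)]
    simp only [Matrix.trace, Matrix.diag_apply, Matrix.mul_apply, Finset.mul_sum, mul_assoc]
  have hder : ∀ a, pderiv a (D a * M ^ (2 * q + 1)).trace =
      ((D a).map (pderiv a) * M ^ (2 * q + 1)).trace +
        ∑ j ∈ Finset.range (2 * q + 1), (D a * M ^ j * D a * M ^ (2 * q - j)).trace := by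
    intro a
    rw [pderiv_trace, map_pderiv_mul, Matrix.trace_add, map_pderiv_pow, Finset.mul_sum,
      Matrix.trace_sum]
    refine congrArg₂ (· + ·) rfl ?_
    exact Finset.sum_congr rfl fun j _ => by
      simp only [Matrix.mul_assoc, hDdef]; rfl
  have hint : 2 * ∫ g, ((eval g).mapMatrix M ^ (2 * q + 2)).trace ∂γ =
      ∫ g, eval g (∑ a, ∑ j ∈ Finset.range (2 * q + 1),
        (D a * M ^ j * D a * M ^ (2 * q - j)).trace) ∂γ := by
    have e1 : ∀ g : ι → ℝ, ((eval g).mapMatrix M ^ (2 * q + 2)).trace =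
        eval g (M ^ (2 * q + 2)).trace := fun g => by rw [eval_trace, map_pow]
    simp only [e1]
    rw [← integral_const_mul]
    have e2 : ∀ g : ι → ℝ, 2 * eval g (M ^ (2 * q + 2)).trace =
        ∑ a, (eval g (X a * (D a * M ^ (2 * q + 1)).trace) -
          eval g ((D a).map (pderiv a) * M ^ (2 * q + 1)).trace) := by
      intro g
      have := congrArg (eval g) key
      simpa only [map_mul, map_sum, map_sub, map_ofNat] using this
    simp only [e2, map_sum]
    have e3 : ∀ a, Integrable (fun g : ι → ℝ => eval g (X a * (D a * M ^ (2 * q + 1)).trace) -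
        eval g ((D a).map (pderiv a) * M ^ (2 * q + 1)).trace) γ :=
      fun a => (integrable_eval _).sub (integrable_eval _)
    rw [integral_finsetSum _ fun a _ => e3 a,
      integral_finsetSum _ fun a _ => integrable_finsetSum _ fun j _ => integrable_eval _]
    refine Finset.sum_congr rfl fun a _ => ?_
    rw [integral_sub (integrable_eval _) (integrable_eval _), integral_mul_eval, hder]
    simp only [map_add, map_sum]
    rw [integral_add (integrable_eval _) (integrable_finsetSum _ fun j _ => integrable_eval _)]
    ring
  rw [hint]
  have e3 : ∀ g : ι → ℝ, (2 * q + 1) * ∑ a, ((eval g).mapMatrix (D a) *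
        (eval g).mapMatrix (D a) * (eval g).mapMatrix M ^ (2 * q)).trace =
      eval g ((2 * q + 1) * ∑ a, (D a * D a * M ^ (2 * q)).trace) := by
    intro g
    simp only [map_mul, map_add, map_sum, eval_trace, map_pow, map_ofNat, map_natCast, map_one]
  refine le_of_le_of_eq ?_ (integral_congr_ae (ae_of_all γ e3)).symm
  refine integral_mono (integrable_eval _) (integrable_eval _) fun g => ?_
  beta_reduce
  rw [← e3 g, map_sum, Finset.mul_sum]
  refine Finset.sum_le_sum fun a _ => ?_
  rw [map_sum]
  calc ∑ j ∈ Finset.range (2 * q + 1), eval g (D a * M ^ j * D a * M ^ (2 * q - j)).trace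
      ≤ ∑ j ∈ Finset.range (2 * q + 1), ((eval g).mapMatrix (D a) *
        (eval g).mapMatrix (D a) * (eval g).mapMatrix M ^ (2 * q)).trace := by
        refine Finset.sum_le_sum fun j hj => ?_
        have := Finset.mem_range.1 hj
        rw [eval_trace]
        simp only [map_mul, map_pow]
        exact SymmMatrix.trace_mul_pow_mul_mul_pow_le (hcommD g a) (hcomm g) (by omega)
    _ = _ := by simp

/-- The moment bound of `integral_trace_pow_le` in closed form, for a matrix whose derivatives are
themselves controlled by its operator norm: `∑ a, ‖(∂_a M) y‖² ≤ (s² + s μ) w ‖y‖²` whenever `μ`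
bounds the operator norm of `M`. -/
theorem integral_trace_pow_le_of_derivative_bound [Fintype ι] [DecidableEq κ] [Nonempty κ]
    {M : Matrix κ κ (MvPolynomial ι ℝ)} (hM : M.IsSymm)
    (hOU : ∀ r c, ∑ a, (X a * pderiv a (M r c) - pderiv a (pderiv a (M r c))) = 2 * M r c)
    {s w : ℝ} (hs : 0 ≤ s) (hw : 1 ≤ w)
    (hD : ∀ (g : ι → ℝ) (μ : ℝ), 0 ≤ μ →
      (∀ y z : κ → ℝ, (y ⬝ᵥ (eval g).mapMatrix M *ᵥ z) ^ 2 ≤ μ ^ 2 * ((y ⬝ᵥ y) * (z ⬝ᵥ z))) →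
      ∀ y : κ → ℝ, ∑ a, ((eval g).mapMatrix (M.map (pderiv a)) *ᵥ y) ⬝ᵥ
        ((eval g).mapMatrix (M.map (pderiv a)) *ᵥ y) ≤ (s ^ 2 + s * μ) * w * (y ⬝ᵥ y))
    {q : ℕ} (hq : (Fintype.card κ : ℝ) ≤ 3 ^ (2 * q)) :
    ∫ g : ι → ℝ, ((eval g).mapMatrix M ^ (2 * q + 2)).trace
        ∂(Measure.pi fun _ => gaussianReal 0 1) ≤
      2 * (Fintype.card κ * (16 * ((2 * q + 1) * w * s)) ^ (2 * q + 2)) := by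
  have h := integral_trace_pow_le hM hOU q
  set γ : Measure (ι → ℝ) := Measure.pi fun _ => gaussianReal 0 1
  set B : ℝ := 2 * (Fintype.card κ * (16 * ((2 * q + 1) * w * s)) ^ (2 * q + 2))
  have hI : Integrable (fun g : ι → ℝ => ((eval g).mapMatrix M ^ (2 * q + 2)).trace) γ := by
    refine (integrable_eval (M ^ (2 * q + 2)).trace).congr (ae_of_all _ fun g => ?_)
    simp only [eval_trace, map_pow]
  have hpt : ∀ g : ι → ℝ, (2 * q + 1) * ∑ a, ((eval g).mapMatrix (M.map (pderiv a)) *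
        (eval g).mapMatrix (M.map (pderiv a)) * (eval g).mapMatrix M ^ (2 * q)).trace ≤
      ((eval g).mapMatrix M ^ (2 * q + 2)).trace / 2 + B := by
    intro g
    have hsym : ((eval g).mapMatrix M).IsSymm := hM.map _
    have hsymD : ∀ a, ((eval g).mapMatrix (M.map (pderiv a))).IsSymm := fun a =>
      (hM.map _).map _
    have hα : 0 ≤ (2 * q + 1) * w * s := by positivity
    obtain ⟨μ, hμ, hop, hle⟩ := SymmMatrix.exists_opNorm_bound hsym hα hq
    have h1 := SymmMatrix.sum_trace_sq_mul_pow_le hsymD hsym (hD g μ hμ hop) q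
    have htr := SymmMatrix.trace_pow_nonneg hsym q
    refine le_trans ?_ hle
    have hc : (1 : ℝ) ≤ (2 * q + 1) * w := by
      have : (1 : ℝ) ≤ 2 * q + 1 := by linarith [Nat.cast_nonneg (α := ℝ) q]
      nlinarith
    have h2 : (2 * q + 1) * ((s ^ 2 + s * μ) * w) ≤
        ((2 * q + 1) * w * s) ^ 2 + (2 * q + 1) * w * s * μ := by
      have : (2 * q + 1) * w * s ^ 2 ≤ ((2 * q + 1) * w) ^ 2 * s ^ 2 :=
        mul_le_mul_of_nonneg_right (by nlinarith) (sq_nonneg s)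
      nlinarith
    calc _ ≤ (2 * q + 1) * ((s ^ 2 + s * μ) * w * ((eval g).mapMatrix M ^ (2 * q)).trace) :=
          mul_le_mul_of_nonneg_left h1 (by positivity)
      _ = (2 * q + 1) * ((s ^ 2 + s * μ) * w) * ((eval g).mapMatrix M ^ (2 * q)).trace := by ring
      _ ≤ _ := mul_le_mul_of_nonneg_right h2 htr
  have hI2 : Integrable (fun g : ι → ℝ => (2 * q + 1 : ℝ) * ∑ a,
      ((eval g).mapMatrix (M.map (pderiv a)) * (eval g).mapMatrix (M.map (pderiv a)) *
        (eval g).mapMatrix M ^ (2 * q)).trace) γ := by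
    refine (integrable_eval (((2 * q + 1 : ℕ) : MvPolynomial ι ℝ) *
      ∑ a, (M.map (pderiv a) * M.map (pderiv a) * M ^ (2 * q)).trace)).congr
      (ae_of_all _ fun g => ?_)
    simp only [map_mul, map_sum, eval_trace, map_pow, map_natCast]
    push_cast
    rfl
  have h2 := integral_mono hI2 ((hI.div_const 2).add (integrable_const B)) hpt
  have h3 : ∫ g, (((eval g).mapMatrix M ^ (2 * q + 2)).trace / 2 + B) ∂γ =
      (∫ g, ((eval g).mapMatrix M ^ (2 * q + 2)).trace ∂γ) / 2 + B := by
    rw [integral_add (hI.div_const 2) (integrable_const B), integral_div]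
    simp [γ]
  have h4 := h.trans (h2.trans_eq h3)
  have hB : 0 ≤ B := by
    have : 0 ≤ (16 * ((2 * q + 1) * w * s)) ^ (2 * q + 2) := by positivity
    positivity
  linarith

end GaussianPoly

namespace SoS

open MvPolynomial
open scoped Matrix

variable {n : ℕ}

/-! ### The squared flattening of a symmetrised Gaussian tensor -/

/-- The symmetrisation of a 3-tensor: the sum (not the average) over the six permutations of the
indices. -/
def symTensor {R : Type*} [Add R] (A : Fin n × Fin n × Fin n → R) (i j k : Fin n) : R :=
  A (i, j, k) + A (i, k, j) + A (j, i, k) + A (j, k, i) + A (k, i, j) + A (k, j, i)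

/-- A 3-tensor that is invariant under permutations of its indices. -/
structure IsSymTensor {R : Type*} (S : Fin n → Fin n → Fin n → R) : Prop where
  swap_left : ∀ i j k, S i j k = S j i k
  swap_right : ∀ i j k, S i j k = S i k j

theorem isSymTensor_symTensor {R : Type*} [AddCommMonoid R] (A : Fin n × Fin n × Fin n → R) :
    IsSymTensor (symTensor A) :=
  ⟨fun i j k => by unfold symTensor; abel, fun i j k => by unfold symTensor; abel⟩

/-- The matrix `∑ k, S_k ⊗ S_k` on `ℝⁿ ⊗ ℝⁿ`, where `S_k` is the `k`-th slice of `S`; as a quadratic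
form it is `Y ↦ ∑ k, tr (Yᵀ S_k Y S_kᵀ)`. -/
def sqFlat {R : Type*} [CommSemiring R] (S : Fin n → Fin n → Fin n → R) :
    Matrix (Fin n × Fin n) (Fin n × Fin n) R :=
  Matrix.of fun p q => ∑ k, S k p.1 q.1 * S k p.2 q.2

/-- The expectation of `sqFlat (symTensor A)` for a Gaussian tensor `A`. -/
def meanFlat (n : ℕ) : Matrix (Fin n × Fin n) (Fin n × Fin n) ℝ :=
  Matrix.of fun p q => 6 * (n + 2) * ((if p.1 = p.2 then 1 else 0) * (if q.1 = q.2 then 1 else 0) +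
    (if p.1 = q.2 then 1 else 0) * (if p.2 = q.1 then 1 else 0))

/-- The centred matrix `sqFlat (symTensor A)`. -/
def centredFlat (A : Tensor3 n) : Matrix (Fin n × Fin n) (Fin n × Fin n) ℝ :=
  sqFlat (symTensor A) - meanFlat n

/-- `centredFlat A` as a matrix of polynomials in the entries of `A`. -/
noncomputable def centredFlatPoly (n : ℕ) :
    Matrix (Fin n × Fin n) (Fin n × Fin n) (MvPolynomial (Fin n × Fin n × Fin n) ℝ) :=
  sqFlat (symTensor X) - (meanFlat n).map C

/-- The symmetrisation of the unit tensor at `a`, i.e. the partial derivative of `symTensor A` in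
the direction of the entry `a` of `A`. -/
def symUnit (a : Fin n × Fin n × Fin n) : Fin n → Fin n → Fin n → ℝ :=
  symTensor (Pi.single a 1)

theorem sqFlat_isSymm {R : Type*} [CommSemiring R] {S : Fin n → Fin n → Fin n → R}
    (hS : IsSymTensor S) : (sqFlat S).IsSymm := by
  ext p q
  simp only [sqFlat, Matrix.transpose_apply, Matrix.of_apply]
  exact Finset.sum_congr rfl fun k _ => by rw [hS.swap_right k q.1, hS.swap_right k q.2]

theorem meanFlat_isSymm (n : ℕ) : (meanFlat n).IsSymm := by
  ext p q
  simp only [meanFlat, Matrix.transpose_apply, Matrix.of_apply]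
  rw [mul_comm (if q.1 = q.2 then (1 : ℝ) else 0), mul_comm (if q.1 = p.2 then (1 : ℝ) else 0)]
  simp only [eq_comm]

theorem centredFlatPoly_isSymm (n : ℕ) : (centredFlatPoly n).IsSymm :=
  (sqFlat_isSymm (isSymTensor_symTensor _)).sub ((meanFlat_isSymm n).map _)

theorem centredFlat_isSymm (A : Tensor3 n) : (centredFlat A).IsSymm :=
  (sqFlat_isSymm (isSymTensor_symTensor _)).sub (meanFlat_isSymm n)

theorem eval_symTensor_X (g : Tensor3 n) (i j k : Fin n) :
    eval g (symTensor X i j k) = symTensor g i j k := by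
  simp [symTensor]

theorem eval_centredFlatPoly (g : Tensor3 n) :
    (eval g).mapMatrix (centredFlatPoly n) = centredFlat g := by
  ext p q
  simp [centredFlatPoly, centredFlat, sqFlat, eval_symTensor_X]

theorem pderiv_symTensor_X (a : Fin n × Fin n × Fin n) (i j k : Fin n) :
    pderiv a (symTensor X i j k : MvPolynomial _ ℝ) = C (symUnit a i j k) := by
  have h : ∀ b : Fin n × Fin n × Fin n, pderiv a (X b : MvPolynomial _ ℝ) =
      C ((Pi.single a 1 : Fin n × Fin n × Fin n → ℝ) b) := by
    intro b
    rw [pderiv_X]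
    by_cases hb : b = a
    · subst hb; simp
    · simp [hb]
  simp only [symTensor, symUnit, map_add, h]

theorem sum_symUnit_mul (f : Fin n × Fin n × Fin n → ℝ) (i j k : Fin n) :
    ∑ a, symUnit a i j k * f a = symTensor f i j k := by
  simp [symUnit, symTensor, add_mul, Finset.sum_add_distrib, Pi.single_apply]

theorem sum_X_mul_symUnit (i j k : Fin n) :
    ∑ a, (X a : MvPolynomial (Fin n × Fin n × Fin n) ℝ) * C (symUnit a i j k) =
      symTensor X i j k := by
  simp [symUnit, symTensor, mul_add, Finset.sum_add_distrib, Pi.single_apply]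

theorem sum_symUnit_mul_symUnit (i j k i' j' k' : Fin n) :
    ∑ a, symUnit a i j k * symUnit a i' j' k' = 6 * symUnit (i, j, k) i' j' k' := by
  rw [sum_symUnit_mul]
  have h1 : ∀ a b c, symUnit (a, b, c) i' j' k' = symUnit (b, a, c) i' j' k' := by
    intro a b c
    simp only [symUnit, symTensor, Pi.single_apply, Prod.mk.injEq, and_assoc, and_comm,
      and_left_comm]
    ring
  have h2 : ∀ a b c, symUnit (a, b, c) i' j' k' = symUnit (a, c, b) i' j' k' := by
    intro a b c
    simp only [symUnit, symTensor, Pi.single_apply, Prod.mk.injEq, and_assoc, and_comm,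
      and_left_comm]
    ring
  simp only [symTensor]
  rw [← h2 i j k, ← h1 i j k, h2 j k i, ← h1 i j k, h1 k i j, ← h2 i j k,
    h2 k j i, h1 k i j, ← h2 i j k]
  ring

theorem sum_symUnit_mul_symUnit_eq_meanFlat (p q : Fin n × Fin n) :
    ∑ k, ∑ a, symUnit a k p.1 q.1 * symUnit a k p.2 q.2 = meanFlat n p q := by
  simp only [sum_symUnit_mul_symUnit, ← Finset.mul_sum]
  simp only [symUnit, symTensor, Pi.single_apply, Prod.mk.injEq, Finset.sum_add_distrib, meanFlat,
    Matrix.of_apply]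
  obtain ⟨j, l⟩ := p
  obtain ⟨i, m⟩ := q
  simp [ite_and, Finset.sum_ite_eq]
  simp only [eq_comm (a := i) (b := m), eq_comm (a := j) (b := l), eq_comm (a := j) (b := m)]
  split_ifs <;> ring

/-- The entries of `centredFlatPoly` are centred quadratic forms, hence eigenfunctions of the
Ornstein–Uhlenbeck operator of eigenvalue `2`; the constant term vanishes exactly because
`meanFlat` is the expectation. -/
theorem centredFlatPoly_eigen (p q : Fin n × Fin n) :
    ∑ a, (X a * pderiv a (centredFlatPoly n p q) -
      pderiv a (pderiv a (centredFlatPoly n p q))) = 2 * centredFlatPoly n p q := by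
  have h1 : ∀ a, pderiv a (centredFlatPoly n p q) =
      ∑ k, (C (symUnit a k p.1 q.1) * symTensor X k p.2 q.2 +
        symTensor X k p.1 q.1 * C (symUnit a k p.2 q.2)) := by
    intro a
    simp only [centredFlatPoly, sqFlat, Matrix.sub_apply, Matrix.of_apply, Matrix.map_apply,
      map_sub, map_sum, pderiv_mul, pderiv_symTensor_X, pderiv_C, sub_zero]
  have h2 : ∀ a, pderiv a (pderiv a (centredFlatPoly n p q)) =
      C (2 * ∑ k, symUnit a k p.1 q.1 * symUnit a k p.2 q.2) := by
    intro a
    rw [h1]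
    simp only [map_sum, map_add, pderiv_mul, pderiv_C, pderiv_symTensor_X, zero_mul, mul_zero,
      zero_add, add_zero, map_mul, Finset.mul_sum, map_ofNat]
    exact Finset.sum_congr rfl fun k _ => by ring
  have h3 : ∑ a, X a * pderiv a (centredFlatPoly n p q) =
      2 * ∑ k, (symTensor X k p.1 q.1 * symTensor X k p.2 q.2 : MvPolynomial _ ℝ) := by
    simp only [h1, Finset.mul_sum]
    rw [Finset.sum_comm]
    refine Finset.sum_congr rfl fun k _ => ?_
    calc _ = (∑ a, X a * C (symUnit a k p.1 q.1)) * symTensor X k p.2 q.2 +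
          symTensor X k p.1 q.1 * ∑ a, X a * C (symUnit a k p.2 q.2) := by
          rw [Finset.sum_mul, Finset.mul_sum, ← Finset.sum_add_distrib]
          exact Finset.sum_congr rfl fun a _ => by ring
      _ = _ := by rw [sum_X_mul_symUnit, sum_X_mul_symUnit]; ring
  rw [Finset.sum_sub_distrib, h3]
  simp only [h2]
  rw [← map_sum, ← Finset.mul_sum, Finset.sum_comm, sum_symUnit_mul_symUnit_eq_meanFlat]
  simp only [centredFlatPoly, sqFlat, Matrix.sub_apply, Matrix.of_apply, Matrix.map_apply, map_mul,
    map_ofNat]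
  ring

theorem eval_pderiv_centredFlatPoly (g : Tensor3 n) (a p q) :
    (eval g).mapMatrix ((centredFlatPoly n).map (pderiv a)) p q =
      ∑ k, (symUnit a k p.1 q.1 * symTensor g k p.2 q.2 +
        symTensor g k p.1 q.1 * symUnit a k p.2 q.2) := by
  simp only [centredFlatPoly, sqFlat, Matrix.sub_apply, Matrix.of_apply, Matrix.map_apply,
    RingHom.mapMatrix_apply, map_sub, map_sum, map_add, map_mul, pderiv_mul, pderiv_symTensor_X,
    pderiv_C, sub_zero, eval_C, eval_symTensor_X]

/-- The inner sum has one term for each of the six permutations, each of squared norm `‖w‖²`; the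
constant is `6 * 6` by Cauchy–Schwarz. -/
theorem sum_sq_symUnit_le (w : Fin n → Fin n → ℝ) (j : Fin n) :
    ∑ a, (∑ k, ∑ i, symUnit a k j i * w k i) ^ 2 ≤ 36 * ∑ k, ∑ i, w k i ^ 2 := by
  set d : Fin n → Fin n → ℝ := fun a b => if a = b then 1 else 0 with hd
  have h1 : ∀ a : Fin n × Fin n × Fin n, ∑ k, ∑ i, symUnit a k j i * w k i =
      d a.2.1 j * w a.1 a.2.2 + d a.2.2 j * w a.1 a.2.1 + d a.1 j * w a.2.1 a.2.2 +
      d a.1 j * w a.2.2 a.2.1 + d a.2.2 j * w a.2.1 a.1 + d a.2.1 j * w a.2.2 a.1 := by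
    rintro ⟨a, b, c⟩
    simp [symUnit, symTensor, Pi.single_apply, add_mul, Finset.sum_add_distrib, ite_and, hd]
    simp only [eq_comm (a := j)]
  have h2 : ∀ a b c d e f : ℝ, (a + b + c + d + e + f) ^ 2 ≤
      6 * (a ^ 2 + b ^ 2 + c ^ 2 + d ^ 2 + e ^ 2 + f ^ 2) := by
    intro a b c d e f
    linarith [sq_nonneg (a - b), sq_nonneg (a - c), sq_nonneg (a - d), sq_nonneg (a - e),
      sq_nonneg (a - f), sq_nonneg (b - c), sq_nonneg (b - d), sq_nonneg (b - e),
      sq_nonneg (b - f), sq_nonneg (c - d), sq_nonneg (c - e), sq_nonneg (c - f),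
      sq_nonneg (d - e), sq_nonneg (d - f), sq_nonneg (e - f)]
  simp only [h1]
  refine (Finset.sum_le_sum fun a _ => h2 _ _ _ _ _ _).trans (le_of_eq ?_)
  rw [← Finset.mul_sum]
  simp only [Fintype.sum_prod_type, mul_pow, Finset.sum_add_distrib]
  have e1 : ∀ a b, d a b ^ 2 = d a b := fun a b => by by_cases h : a = b <;> simp [hd, h]
  have hc : ∑ k, ∑ i, w i k ^ 2 = ∑ k, ∑ i, w k i ^ 2 := Finset.sum_comm
  simp only [e1]
  have t1 : ∑ x, ∑ y, ∑ z, d y j * w x z ^ 2 = ∑ k, ∑ i, w k i ^ 2 := by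
    refine Finset.sum_congr rfl fun x _ => ?_
    rw [Finset.sum_comm]
    simp [hd]
  have t2 : ∑ x, ∑ y, ∑ z, d z j * w x y ^ 2 = ∑ k, ∑ i, w k i ^ 2 := by simp [hd]
  have t3 : ∑ x, ∑ y, ∑ z, d x j * w y z ^ 2 = ∑ k, ∑ i, w k i ^ 2 := by
    simp [hd]
  have t4 : ∑ x, ∑ y, ∑ z, d x j * w z y ^ 2 = ∑ k, ∑ i, w k i ^ 2 := by
    simp [hd, hc]
  have t5 : ∑ x, ∑ y, ∑ z, d z j * w y x ^ 2 = ∑ k, ∑ i, w k i ^ 2 := by simp [hd, hc]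
  have t6 : ∑ x, ∑ y, ∑ z, d y j * w z x ^ 2 = ∑ k, ∑ i, w k i ^ 2 := by
    rw [← hc]
    refine Finset.sum_congr rfl fun x _ => ?_
    rw [Finset.sum_comm]
    simp [hd]
  rw [t1, t2, t3, t4, t5, t6]
  ring

theorem sum_comm_last₃ {α β γ M : Type*} [Fintype α] [Fintype β] [Fintype γ] [AddCommMonoid M]
    (f : α → β → γ → M) : ∑ a, ∑ b, ∑ c, f a b c = ∑ c, ∑ a, ∑ b, f a b c := by
  calc _ = ∑ a, ∑ c, ∑ b, f a b c := Finset.sum_congr rfl fun a _ => Finset.sum_comm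
    _ = _ := Finset.sum_comm

theorem sum_comm_last₄ {α β γ δ M : Type*} [Fintype α] [Fintype β] [Fintype γ] [Fintype δ]
    [AddCommMonoid M] (f : α → β → γ → δ → M) :
    ∑ a, ∑ b, ∑ c, ∑ d, f a b c d = ∑ d, ∑ a, ∑ b, ∑ c, f a b c d := by
  calc _ = ∑ a, ∑ d, ∑ b, ∑ c, f a b c d := Finset.sum_congr rfl fun a _ => sum_comm_last₃ _
    _ = _ := Finset.sum_comm

/-- The identity matrix, as a vector in `ℝⁿ ⊗ ℝⁿ`. -/
def idVec (n : ℕ) : Fin n × Fin n → ℝ := fun z => if z.1 = z.2 then 1 else 0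

/-- `∑ k, ‖Y S_k‖²` is a bilinear form in `sqFlat S`: it equals `⟨Yᵀ Y, ∑ k, S_k I S_k⟩`. -/
theorem sum_sq_mul_slice_eq {S : Fin n → Fin n → Fin n → ℝ} (hS : IsSymTensor S)
    (Y : Fin n → Fin n → ℝ) :
    ∑ k, ∑ i, ∑ l, (∑ m, S k l m * Y i m) ^ 2 =
      (fun z : Fin n × Fin n => ∑ i, Y i z.1 * Y i z.2) ⬝ᵥ sqFlat S *ᵥ idVec n := by
  have h1 : ∀ p, (sqFlat S *ᵥ idVec n) p = ∑ k, ∑ l, S k l p.1 * S k l p.2 := by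
    intro p
    simp only [Matrix.mulVec, dotProduct, sqFlat, Matrix.of_apply, idVec, Fintype.sum_prod_type,
      mul_ite, mul_one, mul_zero, Finset.sum_ite_eq, Finset.mem_univ, if_true]
    rw [Finset.sum_comm]
    exact Finset.sum_congr rfl fun k _ => Finset.sum_congr rfl fun l _ => by
      rw [hS.swap_right k p.1, hS.swap_right k p.2]
  simp only [dotProduct, h1, Fintype.sum_prod_type, sq, Finset.sum_mul_sum]
  rw [sum_comm_last₄]
  refine Finset.sum_congr rfl fun m _ => ?_
  rw [sum_comm_last₄]
  refine Finset.sum_congr rfl fun m' _ => ?_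
  rw [Finset.sum_comm]
  refine Finset.sum_congr rfl fun i _ => Finset.sum_congr rfl fun k _ => ?_
  rw [Finset.mul_sum]
  exact Finset.sum_congr rfl fun l _ => by ring

theorem idVec_dotProduct_self (n : ℕ) : idVec n ⬝ᵥ idVec n = n := by
  simp [dotProduct, idVec, Fintype.sum_prod_type]

theorem meanFlat_mulVec_idVec (n : ℕ) :
    meanFlat n *ᵥ idVec n = (6 * (n + 2) * (n + 1) : ℝ) • idVec n := by
  ext ⟨i, j⟩
  simp only [Matrix.mulVec, dotProduct, meanFlat, Matrix.of_apply, idVec, Fintype.sum_prod_type,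
      mul_ite, mul_one, mul_zero, Finset.sum_ite_eq, Finset.mem_univ, if_true, Pi.smul_apply,
      smul_eq_mul, ← Finset.mul_sum, Finset.sum_add_distrib]
  by_cases h : i = j
  · subst h; simp
  · simp [h]

/-- The bound on `∑ k, ‖Y S_k‖²` that results from `sqFlat S = centredFlat + meanFlat` when `μ`
bounds the operator norm of `centredFlat`. -/
theorem sum_sq_mul_slice_le (g : Tensor3 n) {μ : ℝ} (hμ : 0 ≤ μ)
    (hop : ∀ y z : Fin n × Fin n → ℝ,
      (y ⬝ᵥ centredFlat g *ᵥ z) ^ 2 ≤ μ ^ 2 * ((y ⬝ᵥ y) * (z ⬝ᵥ z)))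
    (Y : Fin n → Fin n → ℝ) :
    ∑ k, ∑ i, ∑ l, (∑ m, symTensor g k l m * Y i m) ^ 2 ≤
      (μ * √n + 6 * (n + 2) * (n + 1)) * ∑ i, ∑ m, Y i m ^ 2 := by
  set F := ∑ i, ∑ m, Y i m ^ 2 with hF
  have hF0 : 0 ≤ F := by positivity
  set z : Fin n × Fin n → ℝ := fun z => ∑ i, Y i z.1 * Y i z.2 with hz
  have hF' : F = ∑ m, ∑ i, Y i m ^ 2 := Finset.sum_comm
  have hzz : z ⬝ᵥ z ≤ F ^ 2 := by
    rw [hF', sq, Finset.sum_mul_sum]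
    simp only [dotProduct, Fintype.sum_prod_type, hz]
    refine Finset.sum_le_sum fun m _ => Finset.sum_le_sum fun m' _ => ?_
    rw [← sq]
    exact Finset.sum_mul_sq_le_sq_mul_sq _ _ _
  have h1 : z ⬝ᵥ centredFlat g *ᵥ idVec n ≤ μ * √n * F := by
    refine le_of_sq_le_sq ((hop z (idVec n)).trans ?_) (by positivity)
    rw [idVec_dotProduct_self, mul_pow, mul_pow, Real.sq_sqrt (Nat.cast_nonneg n)]
    calc μ ^ 2 * (z ⬝ᵥ z * n) ≤ μ ^ 2 * (F ^ 2 * n) := by gcongr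
      _ = _ := by ring
  have h2 : z ⬝ᵥ meanFlat n *ᵥ idVec n = 6 * (n + 2) * (n + 1) * F := by
    rw [meanFlat_mulVec_idVec, dotProduct_smul, smul_eq_mul, hF']
    simp [dotProduct, idVec, Fintype.sum_prod_type, hz, sq]
  have h3 : sqFlat (symTensor g) = centredFlat g + meanFlat n := by simp [centredFlat]
  rw [sum_sq_mul_slice_eq (isSymTensor_symTensor g), h3, Matrix.add_mulVec, dotProduct_add, add_mul]
  exact add_le_add h1 h2.le

/-- The derivatives of `centredFlat` are controlled by its operator norm `μ`: each of them is a sum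
of terms `∂_a S_k ⊗ S_k`, and `∑ k, ‖Y S_k‖²` is a bilinear form in `sqFlat S`. -/
theorem sum_sq_derivative_le (hn : 1 ≤ n) (g : Tensor3 n) {μ : ℝ} (hμ : 0 ≤ μ)
    (hop : ∀ y z : Fin n × Fin n → ℝ,
      (y ⬝ᵥ centredFlat g *ᵥ z) ^ 2 ≤ μ ^ 2 * ((y ⬝ᵥ y) * (z ⬝ᵥ z)))
    (y : Fin n × Fin n → ℝ) :
    ∑ a, ((eval g).mapMatrix ((centredFlatPoly n).map (pderiv a)) *ᵥ y) ⬝ᵥ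
        ((eval g).mapMatrix ((centredFlatPoly n).map (pderiv a)) *ᵥ y) ≤
      ((n * √n) ^ 2 + n * √n * μ) * 5184 * (y ⬝ᵥ y) := by
  set S := symTensor g with hS
  set F := y ⬝ᵥ y with hF
  have hF1 : ∑ i, ∑ m, y (i, m) ^ 2 = F := by
    simp [hF, dotProduct, Fintype.sum_prod_type, sq]
  have hF2 : ∑ m, ∑ i, y (i, m) ^ 2 = F := by rw [← hF1, Finset.sum_comm]
  have hF0 : 0 ≤ F := by rw [← hF1]; positivity
  set W : Fin n → Fin n → Fin n → ℝ := fun k i l => ∑ m, S k l m * y (i, m) with hW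
  set W' : Fin n → Fin n → Fin n → ℝ := fun k m j => ∑ i, S k j i * y (i, m) with hW'
  set c : ℝ := μ * √n + 6 * (n + 2) * (n + 1) with hc
  have hWle : ∑ k, ∑ i, ∑ l, W k i l ^ 2 ≤ c * F := by
    rw [← hF1]; exact sum_sq_mul_slice_le g hμ hop fun i m => y (i, m)
  have hWle' : ∑ k, ∑ m, ∑ j, W' k m j ^ 2 ≤ c * F := by
    rw [← hF2]; exact sum_sq_mul_slice_le g hμ hop fun m i => y (i, m)
  have hD : ∀ a j l, ((eval g).mapMatrix ((centredFlatPoly n).map (pderiv a)) *ᵥ y) (j, l) =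
      ∑ k, ∑ i, symUnit a k j i * W k i l + ∑ k, ∑ m, symUnit a k l m * W' k m j := by
    intro a j l
    simp only [Matrix.mulVec, dotProduct, eval_pderiv_centredFlatPoly, Fintype.sum_prod_type,
      Finset.sum_mul, add_mul, Finset.sum_add_distrib, hW, hW', Finset.mul_sum]
    congr 1
    · rw [sum_comm_last₃]
      exact Finset.sum_congr rfl fun k _ => Finset.sum_congr rfl fun i _ =>
        Finset.sum_congr rfl fun m _ => by ring
    · rw [sum_comm_last₃]
      refine Finset.sum_congr rfl fun k _ => ?_
      rw [Finset.sum_comm]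
      exact Finset.sum_congr rfl fun m _ => Finset.sum_congr rfl fun i _ => by ring
  have h1 : ∀ a, ((eval g).mapMatrix ((centredFlatPoly n).map (pderiv a)) *ᵥ y) ⬝ᵥ
        ((eval g).mapMatrix ((centredFlatPoly n).map (pderiv a)) *ᵥ y) ≤
      2 * (∑ j, ∑ l, (∑ k, ∑ i, symUnit a k j i * W k i l) ^ 2) +
      2 * (∑ j, ∑ l, (∑ k, ∑ m, symUnit a k l m * W' k m j) ^ 2) := by
    intro a
    simp only [dotProduct, Fintype.sum_prod_type, hD, Finset.mul_sum]
    rw [← Finset.sum_add_distrib]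
    refine Finset.sum_le_sum fun j _ => ?_
    rw [← Finset.sum_add_distrib]
    refine Finset.sum_le_sum fun l _ => ?_
    generalize ∑ k, ∑ i, symUnit a k j i * W k i l = u
    generalize ∑ k, ∑ m, symUnit a k l m * W' k m j = v
    linarith [sq_nonneg (u - v)]
  have h2 : ∑ a, ∑ j, ∑ l, (∑ k, ∑ i, symUnit a k j i * W k i l) ^ 2 ≤ 36 * n * (c * F) := by
    have : ∑ a, ∑ j, ∑ l, (∑ k, ∑ i, symUnit a k j i * W k i l) ^ 2 =
        ∑ j, ∑ l, ∑ a, (∑ k, ∑ i, symUnit a k j i * W k i l) ^ 2 := by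
      rw [Finset.sum_comm]
      exact Finset.sum_congr rfl fun j _ => Finset.sum_comm
    rw [this]
    calc _ ≤ ∑ j : Fin n, ∑ l, 36 * ∑ k, ∑ i, W k i l ^ 2 :=
          Finset.sum_le_sum fun j _ => Finset.sum_le_sum fun l _ =>
            sum_sq_symUnit_le (fun k i => W k i l) j
      _ = 36 * n * ∑ l, ∑ k, ∑ i, W k i l ^ 2 := by
          simp [← Finset.mul_sum]; ring
      _ = 36 * n * ∑ k, ∑ i, ∑ l, W k i l ^ 2 := by
          rw [Finset.sum_comm]
          simp only [Finset.sum_comm (f := fun l i => W _ i l ^ 2)]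
      _ ≤ _ := by gcongr
  have h3 : ∑ a, ∑ j, ∑ l, (∑ k, ∑ m, symUnit a k l m * W' k m j) ^ 2 ≤ 36 * n * (c * F) := by
    have : ∑ a, ∑ j, ∑ l, (∑ k, ∑ m, symUnit a k l m * W' k m j) ^ 2 =
        ∑ j, ∑ l, ∑ a, (∑ k, ∑ m, symUnit a k l m * W' k m j) ^ 2 := by
      rw [Finset.sum_comm]
      exact Finset.sum_congr rfl fun j _ => Finset.sum_comm
    rw [this]
    calc _ ≤ ∑ j, ∑ l : Fin n, 36 * ∑ k, ∑ m, W' k m j ^ 2 :=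
          Finset.sum_le_sum fun j _ => Finset.sum_le_sum fun l _ =>
            sum_sq_symUnit_le (fun k i => W' k i j) l
      _ = 36 * n * ∑ j, ∑ k, ∑ m, W' k m j ^ 2 := by
          simp [← Finset.mul_sum]; ring
      _ = 36 * n * ∑ k, ∑ m, ∑ j, W' k m j ^ 2 := by
          rw [Finset.sum_comm]
          simp only [Finset.sum_comm (f := fun l i => W' _ i l ^ 2)]
      _ ≤ _ := by gcongr
  have h4 : n * c ≤ 36 * ((n * √n) ^ 2 + n * √n * μ) := by
    have hn' : (1 : ℝ) ≤ n := by exact_mod_cast hn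
    have hs := Real.sq_sqrt (Nat.cast_nonneg (α := ℝ) n)
    have h5 : (6 : ℝ) * (n + 2) * (n + 1) ≤ 36 * n ^ 2 := by nlinarith
    have h6 : 0 ≤ n * √n * μ := by positivity
    rw [mul_pow, hs, hc]
    nlinarith [mul_le_mul_of_nonneg_left h5 (Nat.cast_nonneg (α := ℝ) n)]
  calc _ ≤ ∑ a, (2 * (∑ j, ∑ l, (∑ k, ∑ i, symUnit a k j i * W k i l) ^ 2) +
      2 * (∑ j, ∑ l, (∑ k, ∑ m, symUnit a k l m * W' k m j) ^ 2)) :=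
        Finset.sum_le_sum fun a _ => h1 a
    _ ≤ 144 * ((n * c) * F) := by
        rw [Finset.sum_add_distrib, ← Finset.mul_sum, ← Finset.mul_sum]
        linarith
    _ ≤ 144 * ((36 * ((n * √n) ^ 2 + n * √n * μ)) * F) := by gcongr
    _ = _ := by ring

/-- The operator norm of `centredFlat A` is at most of order `n ^ (3 / 2) * log n`, except with
probability `2 / n ^ 10`. -/
theorem gaussianTensor_centredFlat_le (hn : 2 ≤ n) :
    gaussianTensor n {A | ¬ ∀ y z : Fin n × Fin n → ℝ, (y ⬝ᵥ centredFlat A *ᵥ z) ^ 2 ≤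
      (5000000 * (n * √n) * Real.log n) ^ 2 * ((y ⬝ᵥ y) * (z ⬝ᵥ z))} ≤
    ENNReal.ofReal (2 / (n : ℝ) ^ 10) := by
  have : Nonempty (Fin n) := ⟨⟨0, by omega⟩⟩
  have hn' : (2 : ℝ) ≤ n := by exact_mod_cast hn
  have hn0 : (0 : ℝ) < n := by linarith
  set ℓ := Real.log n with hℓ
  have hℓ0 : 0.69 ≤ ℓ := by
    have := Real.log_le_log (by norm_num) hn'
    linarith [Real.log_two_gt_d9]
  -- `q ≥ 6 log n` makes `e ^ (2 q) ≥ n ^ 12`, which beats the dimension `n ^ 2` in Markov's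
  -- inequality by the required factor `n ^ 10`
  set q := ⌈6 * ℓ⌉₊ with hq
  have hq1 : 6 * ℓ ≤ q := Nat.le_ceil _
  have hq2 : (q : ℝ) < 6 * ℓ + 1 := Nat.ceil_lt_add_one (by linarith)
  have hexp : (n : ℝ) ^ 12 ≤ Real.exp 1 ^ (2 * q) := by
    rw [← Real.exp_nat_mul, mul_one]
    calc (n : ℝ) ^ 12 = Real.exp (12 * ℓ) := by
          rw [mul_comm, Real.exp_mul, hℓ, Real.exp_log hn0]; norm_cast
      _ ≤ _ := Real.exp_le_exp.2 (by push_cast; linarith)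
  have he3 : Real.exp 1 ≤ 3 := by linarith [Real.exp_one_lt_d9]
  have he1 : 1 ≤ Real.exp 1 := Real.one_le_exp (by norm_num)
  have hcard : (Fintype.card (Fin n × Fin n) : ℝ) ≤ 3 ^ (2 * q) := by
    rw [Fintype.card_prod, Fintype.card_fin]
    push_cast
    calc (n : ℝ) * n = n ^ 2 := by ring
      _ ≤ n ^ 12 := pow_le_pow_right₀ (by linarith) (by norm_num)
      _ ≤ Real.exp 1 ^ (2 * q) := hexp
      _ ≤ _ := pow_le_pow_left₀ (by positivity) he3 _
  have hmom := GaussianPoly.integral_trace_pow_le_of_derivative_bound (centredFlatPoly_isSymm n)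
    centredFlatPoly_eigen (s := n * √n) (w := 5184) (by positivity) (by norm_num)
    (fun g μ hμ hop y => sum_sq_derivative_le (by omega) g hμ
      (by simpa only [eval_centredFlatPoly] using hop) y) hcard
  simp only [eval_centredFlatPoly] at hmom
  set b : ℝ := 16 * ((2 * q + 1) * 5184 * (n * √n)) with hb
  have hb0 : 0 < b := by positivity
  set T : Tensor3 n → ℝ := fun A => (centredFlat A ^ (2 * q + 2)).trace with hT
  have hT0 : ∀ A, 0 ≤ T A := fun A => by
    have := SymmMatrix.trace_pow_nonneg (centredFlat_isSymm A) (q + 1)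
    simpa [hT, mul_add] using this
  have hTi : Integrable T (gaussianTensor n) := by
    refine (GaussianPoly.integrable_eval (centredFlatPoly n ^ (2 * q + 2)).trace).congr
      (ae_of_all _ fun g => ?_)
    beta_reduce
    rw [GaussianPoly.eval_trace, map_pow, eval_centredFlatPoly]
  -- exceeding the norm bound forces the trace moment to exceed its mean by `e ^ (2 q + 2) / n ^ 2`
  have hsub : {A : Tensor3 n | ¬ ∀ y z : Fin n × Fin n → ℝ, (y ⬝ᵥ centredFlat A *ᵥ z) ^ 2 ≤
      (5000000 * (n * √n) * ℓ) ^ 2 * ((y ⬝ᵥ y) * (z ⬝ᵥ z))} ⊆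
      {A | (Real.exp 1 * b) ^ (2 * q + 2) ≤ T A} := by
    intro A hA
    by_contra hlt
    refine hA fun y z => ?_
    have h1 := SymmMatrix.dotProduct_mulVec_sq_le_of_trace (centredFlat_isSymm A)
      (p := q + 1) (by omega) (b := Real.exp 1 * b)
      (by rw [mul_add, mul_one]; exact (not_le.1 hlt).le) y z
    refine h1.trans ?_
    have hyy : 0 ≤ (y ⬝ᵥ y) * (z ⬝ᵥ z) :=
      mul_nonneg (Finset.sum_nonneg fun i _ => mul_self_nonneg _)
        (Finset.sum_nonneg fun i _ => mul_self_nonneg _)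
    have h2 : Real.exp 1 * b ≤ 5000000 * (n * √n) * ℓ := by
      have h3 : (2 * q + 1 : ℝ) ≤ 18 * ℓ := by linarith
      calc Real.exp 1 * b ≤ 3 * (16 * (18 * ℓ * 5184 * (n * √n))) := by
            rw [hb]; gcongr
        _ = 4478976 * (n * √n) * ℓ := by ring
        _ ≤ _ := by gcongr; norm_num
    gcongr
  have hmark := mul_meas_ge_le_integral_of_nonneg (ae_of_all _ hT0) hTi
    ((Real.exp 1 * b) ^ (2 * q + 2))
  have hprob : (gaussianTensor n).real {A | (Real.exp 1 * b) ^ (2 * q + 2) ≤ T A} ≤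
      2 / (n : ℝ) ^ 10 := by
    set P := (gaussianTensor n).real {A | (Real.exp 1 * b) ^ (2 * q + 2) ≤ T A}
    have h1 := hmark.trans hmom
    rw [Fintype.card_prod, Fintype.card_fin, mul_pow] at h1
    push_cast at h1
    have hbp : 0 < b ^ (2 * q + 2) := by positivity
    have h2 : Real.exp 1 ^ (2 * q + 2) * P ≤ 2 * n ^ 2 := by
      refine le_of_mul_le_mul_right ?_ hbp
      linarith
    have h3 : (n : ℝ) ^ 12 ≤ Real.exp 1 ^ (2 * q + 2) :=
      hexp.trans (pow_le_pow_right₀ he1 (by omega))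
    have hP : 0 ≤ P := measureReal_nonneg
    rw [le_div_iff₀ (by positivity)]
    have h4 : (n : ℝ) ^ 12 * P ≤ 2 * n ^ 2 := (mul_le_mul_of_nonneg_right h3 hP).trans h2
    refine le_of_mul_le_mul_right ?_ (show (0 : ℝ) < n ^ 2 by positivity)
    calc P * n ^ 10 * n ^ 2 = n ^ 12 * P := by ring
      _ ≤ _ := h4
  have : IsProbabilityMeasure (gaussianTensor n) := by unfold gaussianTensor; infer_instance
  refine (measure_mono hsub).trans ?_
  rw [← ofReal_measureReal]
  exact ENNReal.ofReal_le_ofReal hprob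

/-! ### Linear functionals with prescribed moments of degree at most four -/

/-- The moments of degree at most four, indexed by lists of coordinates, of the functional with
third moments `t₃` and fourth moments `t₄`. Moments of lower degree are contractions of these, as
the constraint `‖x‖² = 1` demands. -/
def momentList (t₃ : Fin n → Fin n → Fin n → ℝ) (t₄ : Fin n → Fin n → Fin n → Fin n → ℝ) :
    List (Fin n) → ℝ
  | [] => ∑ i, ∑ j, t₄ i i j j
  | [i] => ∑ j, t₃ i j j
  | [i, j] => ∑ k, t₄ i j k k
  | [i, j, k] => t₃ i j k
  | [i, j, k, l] => t₄ i j k l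
  | _ => 0

/-- The linear functional on polynomials with moments `momentList t₃ t₄`; it vanishes on monomials
of degree greater than four. -/
noncomputable def momentFunctional (t₃ : Fin n → Fin n → Fin n → ℝ)
    (t₄ : Fin n → Fin n → Fin n → Fin n → ℝ) : MvPolynomial (Fin n) ℝ →ₗ[ℝ] ℝ :=
  (basisMonomials (Fin n) ℝ).constr ℝ fun m => momentList t₃ t₄ (Finsupp.toMultiset m).toList

/-- A 4-tensor that is invariant under permutations of its indices. -/
structure IsSymTensor4 (t : Fin n → Fin n → Fin n → Fin n → ℝ) : Prop where
  swap₁ : ∀ i j k l, t i j k l = t j i k l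
  swap₂ : ∀ i j k l, t i j k l = t i k j l
  swap₃ : ∀ i j k l, t i j k l = t i j l k

section

variable {t₃ : Fin n → Fin n → Fin n → ℝ} {t₄ : Fin n → Fin n → Fin n → Fin n → ℝ}

/-- The value on a monomial is the moment of its list of variables in some order; which order is
hidden in the choice made by `Multiset.toList`. -/
theorem exists_perm_momentFunctional_eq (l : List (Fin n)) :
    ∃ l' : List (Fin n), l' ∈ l.permutations ∧
      momentFunctional t₃ t₄ (l.map X).prod = momentList t₃ t₄ l' := by
  have h : ((l.map X).prod : MvPolynomial (Fin n) ℝ) =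
      basisMonomials (Fin n) ℝ (Multiset.toFinsupp (l : Multiset (Fin n))) := by
    rw [coe_basisMonomials]
    induction l with
    | nil => simp
    | cons i l ih =>
      rw [List.map_cons, List.prod_cons, ih, X, ← Multiset.cons_coe, ← Multiset.singleton_add,
        map_add, Multiset.toFinsupp_singleton]
      simp only [monomial_mul, mul_one]
  refine ⟨(l : Multiset (Fin n)).toList, ?_, ?_⟩
  · rw [List.mem_permutations, ← Multiset.coe_eq_coe, Multiset.coe_toList]
  · rw [h, momentFunctional, Module.Basis.constr_basis, Multiset.toFinsupp_toMultiset]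

theorem momentFunctional_one : momentFunctional t₃ t₄ 1 = ∑ i, ∑ j, t₄ i i j j := by
  obtain ⟨l, hl, h⟩ := exists_perm_momentFunctional_eq (t₃ := t₃) (t₄ := t₄) []
  simp [List.permutations] at hl
  simpa [hl, momentList] using h

theorem momentFunctional_X (i : Fin n) : momentFunctional t₃ t₄ (X i) = ∑ j, t₃ i j j := by
  obtain ⟨l, hl, h⟩ := exists_perm_momentFunctional_eq (t₃ := t₃) (t₄ := t₄) [i]
  simp [List.permutations] at hl
  simpa [hl, momentList] using h

theorem momentFunctional_X_mul_X (h₄ : IsSymTensor4 t₄) (i j : Fin n) :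
    momentFunctional t₃ t₄ (X i * X j) = ∑ k, t₄ i j k k := by
  obtain ⟨l, hl, h⟩ := exists_perm_momentFunctional_eq (t₃ := t₃) (t₄ := t₄) [i, j]
  simp [List.permutations] at hl h
  rw [h]
  rcases hl with rfl | rfl <;> simp only [momentList]
  exact Finset.sum_congr rfl fun k _ => h₄.swap₁ _ _ _ _

theorem momentFunctional_X_mul_X_mul_X (h₃ : IsSymTensor t₃) (i j k : Fin n) :
    momentFunctional t₃ t₄ (X i * X j * X k) = t₃ i j k := by
  obtain ⟨l, hl, h⟩ := exists_perm_momentFunctional_eq (t₃ := t₃) (t₄ := t₄) [i, j, k]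
  simp [List.permutations] at hl h
  rw [mul_assoc, h]
  have h1 := h₃.swap_left
  have h2 := h₃.swap_right
  rcases hl with rfl | rfl | rfl | rfl | rfl | rfl <;> simp only [momentList] <;> grind

theorem momentFunctional_X_mul_X_mul_X_mul_X (h₄ : IsSymTensor4 t₄) (i j k l : Fin n) :
    momentFunctional t₃ t₄ (X i * X j * (X k * X l)) = t₄ i j k l := by
  obtain ⟨l, hl, h⟩ := exists_perm_momentFunctional_eq (t₃ := t₃) (t₄ := t₄) [i, j, k, l]
  simp [List.permutations] at hl h
  rw [mul_assoc, h]
  have h1 := h₄.swap₁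
  have h2 := h₄.swap₂
  have h3 := h₄.swap₃
  rcases hl with rfl | rfl | rfl | rfl | rfl | rfl | rfl | rfl | rfl | rfl | rfl | rfl | rfl | rfl |
    rfl | rfl | rfl | rfl | rfl | rfl | rfl | rfl | rfl | rfl <;>
    simp only [momentList] <;> grind

end

/-- The quadratic form `⟨x, M x⟩` as a polynomial. -/
noncomputable def quadPoly (M : Fin n → Fin n → ℝ) : MvPolynomial (Fin n) ℝ :=
  ∑ i, ∑ j, C (M i j) * (X i * X j)

/-- The linear form `⟨u, x⟩` as a polynomial. -/
noncomputable def linForm (u : Fin n → ℝ) : MvPolynomial (Fin n) ℝ := ∑ i, C (u i) * X i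

theorem exists_eq_of_totalDegree_le_two {p : MvPolynomial (Fin n) ℝ} (hp : p.totalDegree ≤ 2) :
    ∃ (c : ℝ) (u : Fin n → ℝ) (M : Fin n → Fin n → ℝ), (∀ i j, M i j = M j i) ∧
      p = C c + linForm u + quadPoly M := by
  rw [p.as_sum]
  refine Finset.sum_induction _ (fun p => ∃ (c : ℝ) (u : Fin n → ℝ) (M : Fin n → Fin n → ℝ),
    (∀ i j, M i j = M j i) ∧ p = C c + linForm u + quadPoly M) ?_ ?_ ?_
  · rintro _ _ ⟨c, u, M, hM, rfl⟩ ⟨c', u', M', hM', rfl⟩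
    refine ⟨c + c', u + u', M + M', fun i j => by simp [hM i j, hM' i j], ?_⟩
    simp only [linForm, quadPoly, Pi.add_apply, map_add, add_mul, Finset.sum_add_distrib]
    ring
  · exact ⟨0, 0, 0, by simp, by simp [linForm, quadPoly]⟩
  · intro m hm
    have hd : (Finsupp.toMultiset m).card ≤ 2 := by
      rw [Finsupp.card_toMultiset]; exact (le_totalDegree hm).trans hp
    set r := coeff m p
    have hm' : m = Multiset.toFinsupp (Finsupp.toMultiset m) := by simp
    generalize Finsupp.toMultiset m = s at hm' hd
    interval_cases h : s.card
    · rw [Multiset.card_eq_zero] at h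
      subst h
      refine ⟨r, 0, 0, by simp, ?_⟩
      simp [hm', linForm, quadPoly]
    · obtain ⟨i, rfl⟩ := Multiset.card_eq_one.1 h
      refine ⟨0, Pi.single i r, 0, by simp, ?_⟩
      simp [hm', linForm, quadPoly, Pi.single_apply, X, C_mul_monomial, apply_ite C]
    · obtain ⟨i, j, rfl⟩ := Multiset.card_eq_two.1 h
      refine ⟨0, 0, fun a b => (if a = i then if b = j then r / 2 else 0 else 0) +
        (if a = j then if b = i then r / 2 else 0 else 0), fun a b => ?_, ?_⟩
      · beta_reduce
        split_ifs <;> ring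
      · have e : m = Finsupp.single i 1 + Finsupp.single j 1 := by
          rw [hm', Multiset.insert_eq_cons, ← Multiset.singleton_add, map_add]; simp
        simp [quadPoly, linForm, add_mul, Finset.sum_add_distrib, apply_ite C, ite_mul]
        rw [mul_comm (X j) (X i), ← add_mul, ← C_add, add_halves, e, X, X, monomial_mul,
          C_mul_monomial]
        simp

theorem totalDegree_spherePoly (hn : 1 ≤ n) : (spherePoly n).totalDegree = 2 := by
  let i₀ : Fin n := ⟨0, hn⟩
  apply le_antisymm
  · refine (totalDegree_sub _ _).trans (max_le (totalDegree_finsetSum_le fun i _ => ?_) (by simp))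
    simp [totalDegree_X_pow]
  · have : Finsupp.single i₀ 2 ∈ (spherePoly n).support := by
      rw [mem_support_iff, spherePoly, coeff_sub, coeff_sum]
      have h0 : (0 : Fin n →₀ ℕ) ≠ Finsupp.single i₀ 2 := by
        simp [eq_comm, Finsupp.single_eq_zero]
      simp [coeff_X_pow, coeff_one, Finsupp.single_left_inj, h0]
    simpa using le_totalDegree this

/-- Only multipliers of degree at most two occur in the constraint `‖x‖² = 1`, as no cancellation of
leading terms is possible. -/
theorem totalDegree_le_two_of_spherePoly_mul (hn : 1 ≤ n) {q : MvPolynomial (Fin n) ℝ}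
    (h : (spherePoly n * q).totalDegree ≤ 4) : q.totalDegree ≤ 2 := by
  by_cases hq : q = 0
  · simp [hq]
  · have h2 := totalDegree_spherePoly hn
    have h0 : spherePoly n ≠ 0 := fun h0 => by rw [h0] at h2; simp at h2
    rw [totalDegree_mul_of_isDomain h0 hq, h2] at h
    omega

theorem linForm_mul_linForm (u v : Fin n → ℝ) :
    linForm u * linForm v = ∑ i, ∑ j, (u i * v j) • (X i * X j) := by
  simp only [linForm, Finset.sum_mul_sum]
  refine Finset.sum_congr rfl fun i _ => Finset.sum_congr rfl fun j _ => ?_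
  rw [smul_eq_C_mul, C_mul]; ring

theorem linForm_mul_quadPoly (u : Fin n → ℝ) (M : Fin n → Fin n → ℝ) :
    linForm u * quadPoly M = ∑ k, ∑ i, ∑ j, (u k * M i j) • (X k * X i * X j) := by
  rw [linForm, Finset.sum_mul]
  refine Finset.sum_congr rfl fun k _ => ?_
  rw [quadPoly, Finset.mul_sum]
  refine Finset.sum_congr rfl fun i _ => ?_
  rw [Finset.mul_sum]
  refine Finset.sum_congr rfl fun j _ => ?_
  rw [smul_eq_C_mul, C_mul]; ring

theorem quadPoly_mul_quadPoly (M M' : Fin n → Fin n → ℝ) :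
    quadPoly M * quadPoly M' =
      ∑ i, ∑ j, ∑ k, ∑ l, (M i j * M' k l) • (X i * X j * (X k * X l)) := by
  rw [quadPoly, Finset.sum_mul]
  refine Finset.sum_congr rfl fun i _ => ?_
  rw [Finset.sum_mul]
  refine Finset.sum_congr rfl fun j _ => ?_
  rw [quadPoly, Finset.mul_sum]
  refine Finset.sum_congr rfl fun k _ => ?_
  rw [Finset.mul_sum]
  refine Finset.sum_congr rfl fun l _ => ?_
  rw [smul_eq_C_mul, C_mul]; ring

theorem totalDegree_linForm_le (u : Fin n → ℝ) : (linForm u).totalDegree ≤ 1 :=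
  totalDegree_finsetSum_le fun i _ => totalDegree_C_mul_le _ (totalDegree_X i).le

theorem totalDegree_quadPoly_le (M : Fin n → Fin n → ℝ) : (quadPoly M).totalDegree ≤ 2 := by
  refine totalDegree_finsetSum_le fun i _ => totalDegree_finsetSum_le fun j _ =>
    totalDegree_C_mul_le _ ((totalDegree_mul _ _).trans ?_)
  rw [totalDegree_X, totalDegree_X]

theorem spherePoly_eq : spherePoly n = quadPoly (fun i j => if i = j then 1 else 0) - 1 := by
  simp [spherePoly, quadPoly, sq, apply_ite C]

section

variable {t₃ : Fin n → Fin n → Fin n → ℝ} {t₄ : Fin n → Fin n → Fin n → Fin n → ℝ}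

theorem momentFunctional_spherePoly_mul (h₃ : IsSymTensor t₃) (h₄ : IsSymTensor4 t₄)
    {q : MvPolynomial (Fin n) ℝ} (hq : q.totalDegree ≤ 2) :
    momentFunctional t₃ t₄ (spherePoly n * q) = 0 := by
  obtain ⟨c, u, M, -, rfl⟩ := exists_eq_of_totalDegree_le_two hq
  have e0 : momentFunctional t₃ t₄ (spherePoly n * C c) = 0 := by
    have : spherePoly n * C c = c • ((∑ i, X i * X i) - 1) := by
      rw [smul_eq_C_mul, spherePoly]; simp only [sq]; ring
    rw [this, map_smul, map_sub, map_sum, momentFunctional_one]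
    simp only [momentFunctional_X_mul_X h₄, sub_self, smul_zero]
  have e1 : momentFunctional t₃ t₄ (spherePoly n * linForm u) = 0 := by
    have : spherePoly n * linForm u = ∑ i, u i • ((∑ j, X i * X j * X j) - X i) := by
      rw [spherePoly, linForm, Finset.mul_sum]
      refine Finset.sum_congr rfl fun i _ => ?_
      simp only [smul_eq_C_mul, mul_assoc, ← Finset.mul_sum, ← sq]
      ring
    rw [this, map_sum]
    refine Finset.sum_eq_zero fun i _ => ?_
    rw [map_smul, map_sub, map_sum, momentFunctional_X]
    simp only [momentFunctional_X_mul_X_mul_X h₃, sub_self, smul_zero]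
  have e2 : momentFunctional t₃ t₄ (spherePoly n * quadPoly M) = 0 := by
    have : spherePoly n * quadPoly M =
        ∑ i, ∑ j, M i j • ((∑ k, X i * X j * (X k * X k)) - X i * X j) := by
      rw [spherePoly, quadPoly, Finset.mul_sum]
      refine Finset.sum_congr rfl fun i _ => ?_
      rw [Finset.mul_sum]
      refine Finset.sum_congr rfl fun j _ => ?_
      simp only [smul_eq_C_mul, ← Finset.mul_sum, ← sq]
      ring
    rw [this, map_sum]
    refine Finset.sum_eq_zero fun i _ => ?_
    rw [map_sum]
    refine Finset.sum_eq_zero fun j _ => ?_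
    rw [map_smul, map_sub, map_sum, momentFunctional_X_mul_X h₄]
    simp only [momentFunctional_X_mul_X_mul_X_mul_X h₄, sub_self, smul_zero]
  rw [mul_add, mul_add, map_add, map_add, e0, e1, e2]
  simp

/-- On the sphere every polynomial of degree at most two is the sum of a linear and a quadratic
form, so positivity has to be checked on such sums only. -/
theorem isSpherePseudoDist_momentFunctional (hn : 1 ≤ n) (h₃ : IsSymTensor t₃)
    (h₄ : IsSymTensor4 t₄) (hone : ∑ i, ∑ j, t₄ i i j j = 1)
    (hpos : ∀ (u : Fin n → ℝ) (M : Fin n → Fin n → ℝ), (∀ i j, M i j = M j i) →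
      0 ≤ ∑ i, ∑ j, u i * u j * ∑ k, t₄ i j k k + 2 * ∑ k, ∑ i, ∑ j, u k * M i j * t₃ k i j +
        ∑ i, ∑ j, ∑ k, ∑ l, M i j * M k l * t₄ i j k l) :
    IsSpherePseudoDist ((momentFunctional t₃ t₄).domRestrict (PolyLE n 4)) := by
  refine ⟨⟨?_, ?_⟩, ?_⟩
  · rw [LinearMap.domRestrict_apply]
    exact momentFunctional_one.trans hone
  · intro p hp
    rw [LinearMap.domRestrict_apply]
    rw [mem_polyLE] at hp
    obtain ⟨c, u, M, hM, rfl⟩ := exists_eq_of_totalDegree_le_two hp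
    -- on the sphere the constant `c` may be replaced by the quadratic form `c ‖x‖²`
    set N : Fin n → Fin n → ℝ := fun i j => M i j + if i = j then c else 0 with hN
    have hNs : ∀ i j, N i j = N j i := fun i j => by simp [hN, hM i j, eq_comm]
    have hQ : quadPoly N = quadPoly M + C c * (spherePoly n + 1) := by
      rw [spherePoly_eq]
      simp [quadPoly, hN, add_mul, Finset.sum_add_distrib, Finset.mul_sum, apply_ite C]
    have hsq : (C c + linForm u + quadPoly M) ^ 2 =
        linForm u * linForm u + 2 * (linForm u * quadPoly N) + quadPoly N * quadPoly N -
          spherePoly n * (C c * (C c + 2 * linForm u + quadPoly M + quadPoly N)) := by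
      rw [hQ]; ring
    have hdeg : (C c * (C c + 2 * linForm u + quadPoly M + quadPoly N)).totalDegree ≤ 2 := by
      refine totalDegree_C_mul_le _ ?_
      have h2 : (2 * linForm u).totalDegree ≤ 2 := by
        have := totalDegree_C_mul_le 2 (totalDegree_linForm_le u)
        rw [map_ofNat] at this
        omega
      refine (totalDegree_add _ _).trans (max_le ((totalDegree_add _ _).trans
        (max_le ((totalDegree_add _ _).trans (max_le (by simp) h2))
          (totalDegree_quadPoly_le M))) (totalDegree_quadPoly_le N))
    have h2 : (2 : MvPolynomial (Fin n) ℝ) * (linForm u * quadPoly N) =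
        (2 : ℝ) • (linForm u * quadPoly N) := by
      rw [smul_eq_C_mul, map_ofNat]
    refine le_of_le_of_eq (hpos u N hNs) ?_
    change _ = momentFunctional t₃ t₄ ((C c + linForm u + quadPoly M) ^ 2)
    rw [hsq, map_sub, momentFunctional_spherePoly_mul h₃ h₄ hdeg, h2, map_add, map_add, map_smul,
      linForm_mul_linForm, linForm_mul_quadPoly, quadPoly_mul_quadPoly]
    simp only [map_sum, map_smul, momentFunctional_X_mul_X h₄, momentFunctional_X_mul_X_mul_X h₃,
      momentFunctional_X_mul_X_mul_X_mul_X h₄, smul_eq_mul, sub_zero]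
  · intro q hq
    rw [LinearMap.domRestrict_apply]
    rw [mem_polyLE] at hq
    exact momentFunctional_spherePoly_mul h₃ h₄ (totalDegree_le_two_of_spherePoly_mul hn hq)

end

/-! ### The pseudo-distribution attached to a symmetric tensor -/

/-- Up to normalisation, the fourth moments of the pseudo-distribution attached to `S`: those of the
uniform distribution on the sphere, weighted by `a`, plus the symmetrisation of
`∑ r, S_r ⊗ S_r`. -/
def fourthMoments (a : ℝ) (S : Fin n → Fin n → Fin n → ℝ) (i j k l : Fin n) : ℝ :=
  a * ((if i = j then 1 else 0) * (if k = l then 1 else 0) +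
    (if i = k then 1 else 0) * (if j = l then 1 else 0) +
    (if i = l then 1 else 0) * (if j = k then 1 else 0)) +
  ∑ r, (S r i j * S r k l + S r i k * S r j l + S r i l * S r j k)

theorem isSymTensor4_fourthMoments (a : ℝ) {S : Fin n → Fin n → Fin n → ℝ} (hS : IsSymTensor S) :
    IsSymTensor4 (fourthMoments a S) := by
  have h := hS.swap_right
  refine ⟨fun i j k l => ?_, fun i j k l => ?_, fun i j k l => ?_⟩
  · unfold fourthMoments
    simp only [eq_comm (a := i) (b := j)]
    congr 1
    · ring
    · exact Finset.sum_congr rfl fun r _ => by rw [h r i j]; ring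
  · unfold fourthMoments
    simp only [eq_comm (a := j) (b := k)]
    congr 1
    · ring
    · exact Finset.sum_congr rfl fun r _ => by rw [h r k j]; ring
  · unfold fourthMoments
    simp only [eq_comm (a := k) (b := l)]
    congr 1
    · ring
    · exact Finset.sum_congr rfl fun r _ => by rw [h r k l]; ring

/-- `N` bounds the quadratic form of `sqFlat S`; the trace is allowed for because it is what the
expectation of `sqFlat S` contributes. -/
def FormBound (S : Fin n → Fin n → Fin n → ℝ) (N : ℝ) : Prop :=
  ∀ y : Fin n × Fin n → ℝ, |y ⬝ᵥ sqFlat S *ᵥ y| ≤ N * (y ⬝ᵥ y + (∑ i, y (i, i)) ^ 2)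

theorem sq_sum_sum {α β : Type*} [Fintype α] [Fintype β] (f : α → β → ℝ) :
    (∑ i, ∑ j, f i j) ^ 2 = ∑ i, ∑ j, ∑ k, ∑ l, f i j * f k l := by
  rw [sq, Finset.sum_mul]
  refine Finset.sum_congr rfl fun i _ => ?_
  rw [Finset.sum_mul]
  refine Finset.sum_congr rfl fun j _ => ?_
  rw [Finset.mul_sum]
  exact Finset.sum_congr rfl fun k _ => Finset.mul_sum _ _ _

theorem dotProduct_sqFlat_mulVec (S : Fin n → Fin n → Fin n → ℝ) (y : Fin n × Fin n → ℝ) :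
    y ⬝ᵥ sqFlat S *ᵥ y =
      ∑ i, ∑ j, ∑ k, ∑ l, y (i, j) * y (k, l) * ∑ r, S r i k * S r j l := by
  simp only [dotProduct, Matrix.mulVec, sqFlat, Matrix.of_apply, Fintype.sum_prod_type,
    Finset.mul_sum]
  refine Finset.sum_congr rfl fun i _ => Finset.sum_congr rfl fun j _ =>
    Finset.sum_congr rfl fun k _ => Finset.sum_congr rfl fun l _ => ?_
  rw [Finset.sum_mul, Finset.mul_sum]
  exact Finset.sum_congr rfl fun r _ => by ring

section

variable {S : Fin n → Fin n → Fin n → ℝ} {N : ℝ}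

/-- The value of the quadratic form of `sqFlat S` at `u ⊗ u`. -/
theorem sum_sq_form_le (hN : FormBound S N) (u : Fin n → ℝ) :
    ∑ r, (∑ i, ∑ j, u i * u j * S r i j) ^ 2 ≤ 2 * N * (∑ i, u i ^ 2) ^ 2 := by
  have h := (le_abs_self _).trans (hN fun p => u p.1 * u p.2)
  have e1 : (fun p : Fin n × Fin n => u p.1 * u p.2) ⬝ᵥ
      sqFlat S *ᵥ (fun p : Fin n × Fin n => u p.1 * u p.2) =
      ∑ r, (∑ i, ∑ j, u i * u j * S r i j) ^ 2 := by
    rw [dotProduct_sqFlat_mulVec]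
    simp only [Finset.mul_sum]
    rw [Finset.sum_congr rfl fun i _ => sum_comm_last₄ _, Finset.sum_comm]
    refine Finset.sum_congr rfl fun r _ => ?_
    rw [sq_sum_sum]
    refine Finset.sum_congr rfl fun i _ => ?_
    rw [Finset.sum_comm]
    exact Finset.sum_congr rfl fun j _ => Finset.sum_congr rfl fun k _ =>
      Finset.sum_congr rfl fun l _ => by ring
  have e2 : (fun p : Fin n × Fin n => u p.1 * u p.2) ⬝ᵥ (fun p : Fin n × Fin n => u p.1 * u p.2) =
      (∑ i, u i ^ 2) ^ 2 := by
    simp only [dotProduct, Fintype.sum_prod_type, sq, Finset.sum_mul_sum]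
    exact Finset.sum_congr rfl fun i _ => Finset.sum_congr rfl fun j _ => by ring
  rw [e1, e2] at h
  simp only [← sq] at h
  linarith

theorem sum_sq_trace_le (hN : FormBound S N) (hN0 : 0 ≤ N) :
    ∑ r, (∑ i, S r i i) ^ 2 ≤ 2 * N * n ^ 2 := by
  have h1 : ∀ i j, ∑ r, S r i i * S r j j ≤ 2 * N := by
    intro i j
    have h := (le_abs_self _).trans (hN (Pi.single (i, j) 1))
    have e : (∑ k, (Pi.single (i, j) 1 : Fin n × Fin n → ℝ) (k, k)) ^ 2 ≤ 1 := by
      by_cases hij : i = j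
      · subst hij; simp [Pi.single_apply]
      · have : ∀ k, (k, k) ≠ (i, j) := fun k hk => hij (by
          rw [Prod.mk.injEq] at hk; exact hk.1.symm.trans hk.2)
        simp [this]
    simp [sqFlat] at h
    nlinarith
  have h2 : ∑ r, (∑ i, S r i i) ^ 2 = ∑ i, ∑ j, ∑ r, S r i i * S r j j := by
    rw [sum_comm_last₃]
    simp only [sq, Finset.sum_mul_sum]
  rw [h2]
  calc _ ≤ ∑ i : Fin n, ∑ j : Fin n, 2 * N :=
        Finset.sum_le_sum fun i _ => Finset.sum_le_sum fun j _ => h1 i j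
    _ = _ := by simp; ring

/-- The three pairings of the indices contribute separately to the fourth moments of `⟨x, M x⟩²`;
for symmetric `M` the two crossed pairings agree. -/
theorem sum_fourthMoments_quad (a : ℝ) {M : Fin n → Fin n → ℝ} (hM : ∀ i j, M i j = M j i) :
    ∑ i, ∑ j, ∑ k, ∑ l, M i j * M k l * fourthMoments a S i j k l =
      a * ((∑ i, M i i) ^ 2 + 2 * ∑ i, ∑ j, M i j ^ 2) + ∑ r, (∑ i, ∑ j, M i j * S r i j) ^ 2 +
        2 * ((fun p : Fin n × Fin n => M p.1 p.2) ⬝ᵥ sqFlat S *ᵥ fun p => M p.1 p.2) := by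
  have e1 : ∑ i, ∑ j, ∑ k, ∑ l, M i j * M k l * ((if i = j then (1 : ℝ) else 0) *
      (if k = l then 1 else 0)) = (∑ i, M i i) ^ 2 := by
    have : ∑ i, M i i = ∑ i, ∑ j, M i j * (if i = j then (1 : ℝ) else 0) := by simp
    rw [this, sq_sum_sum]
    exact Finset.sum_congr rfl fun i _ => Finset.sum_congr rfl fun j _ =>
      Finset.sum_congr rfl fun k _ => Finset.sum_congr rfl fun l _ => by ring
  have e2 : ∑ i, ∑ j, ∑ k, ∑ l, M i j * M k l * ((if i = k then (1 : ℝ) else 0) *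
      (if j = l then 1 else 0)) = ∑ i, ∑ j, M i j ^ 2 := by
    simp [sq]
  have e3 : ∑ i, ∑ j, ∑ k, ∑ l, M i j * M k l * ((if i = l then (1 : ℝ) else 0) *
      (if j = k then 1 else 0)) = ∑ i, ∑ j, M i j ^ 2 := by
    simp only [mul_ite, mul_one, mul_zero]
    simp [hM, sq]
  have e4 : ∑ i, ∑ j, ∑ k, ∑ l, M i j * M k l * ∑ r, S r i j * S r k l =
      ∑ r, (∑ i, ∑ j, M i j * S r i j) ^ 2 := by
    simp only [Finset.mul_sum]
    rw [Finset.sum_congr rfl fun i _ => sum_comm_last₄ _, Finset.sum_comm]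
    refine Finset.sum_congr rfl fun r _ => ?_
    rw [sq_sum_sum]
    exact Finset.sum_congr rfl fun i _ => Finset.sum_congr rfl fun j _ =>
      Finset.sum_congr rfl fun k _ => Finset.sum_congr rfl fun l _ => by ring
  have e5 := dotProduct_sqFlat_mulVec S fun p => M p.1 p.2
  have e6 : ∑ i, ∑ j, ∑ k, ∑ l, M i j * M k l * ∑ r, S r i l * S r j k =
      ∑ i, ∑ j, ∑ k, ∑ l, M i j * M k l * ∑ r, S r i k * S r j l := by
    refine Finset.sum_congr rfl fun i _ => Finset.sum_congr rfl fun j _ => ?_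
    rw [Finset.sum_comm]
    exact Finset.sum_congr rfl fun k _ => Finset.sum_congr rfl fun l _ => by rw [hM k l]
  calc _ = ∑ i, ∑ j, ∑ k, ∑ l, (a * (M i j * M k l * ((if i = j then (1 : ℝ) else 0) *
        (if k = l then 1 else 0))) + a * (M i j * M k l * ((if i = k then (1 : ℝ) else 0) *
        (if j = l then 1 else 0))) + a * (M i j * M k l * ((if i = l then (1 : ℝ) else 0) *
        (if j = k then 1 else 0))) + M i j * M k l * ∑ r, S r i j * S r k l +
        M i j * M k l * ∑ r, S r i k * S r j l + M i j * M k l * ∑ r, S r i l * S r j k) := by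
        refine Finset.sum_congr rfl fun i _ => Finset.sum_congr rfl fun j _ =>
          Finset.sum_congr rfl fun k _ => Finset.sum_congr rfl fun l _ => ?_
        simp only [fourthMoments, Finset.sum_add_distrib]
        ring
    _ = _ := by
        simp only [Finset.sum_add_distrib, ← Finset.mul_sum (a := a)]
        rw [e1, e2, e3, e4, e5, e6]
        ring

theorem sum_fourthMoments_lin (a : ℝ) (u : Fin n → ℝ) :
    ∑ i, ∑ j, u i * u j * ∑ k, fourthMoments a S i j k k =
      a * (n + 2) * ∑ i, u i ^ 2 + ∑ r, (∑ k, S r k k) * (∑ i, ∑ j, u i * u j * S r i j) +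
        2 * ∑ r, ∑ k, (∑ i, u i * S r i k) ^ 2 := by
  have e0 : ∀ i j, ∑ k, fourthMoments a S i j k k = a * (n + 2) * (if i = j then 1 else 0) +
      ∑ r, S r i j * (∑ k, S r k k) + 2 * ∑ r, ∑ k, S r i k * S r j k := by
    intro i j
    simp only [fourthMoments, Finset.sum_add_distrib, ← Finset.mul_sum]
    rw [Finset.sum_comm, Finset.sum_comm (f := fun k r => S r i k * S r j k)]
    simp only [← Finset.mul_sum]
    simp [eq_comm (a := j)]
    split_ifs <;> ring
  have e1 : ∑ i, ∑ j, u i * u j * (if i = j then (1 : ℝ) else 0) = ∑ i, u i ^ 2 := by simp [sq]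
  have e2 : ∀ τ : Fin n → ℝ, ∑ i, ∑ j, u i * u j * ∑ r, S r i j * τ r =
      ∑ r, τ r * (∑ i, ∑ j, u i * u j * S r i j) := by
    intro τ
    simp only [Finset.mul_sum]
    rw [sum_comm_last₃]
    exact Finset.sum_congr rfl fun r _ => Finset.sum_congr rfl fun i _ =>
      Finset.sum_congr rfl fun j _ => by ring
  have e3 : ∑ i, ∑ j, u i * u j * ∑ r, ∑ k, S r i k * S r j k =
      ∑ r, ∑ k, (∑ i, u i * S r i k) ^ 2 := by
    simp only [sq, Finset.sum_mul_sum]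
    simp only [Finset.mul_sum]
    rw [sum_comm_last₄, Finset.sum_congr rfl fun k _ => sum_comm_last₃ _, Finset.sum_comm]
    exact Finset.sum_congr rfl fun r _ => Finset.sum_congr rfl fun k _ =>
      Finset.sum_congr rfl fun i _ => Finset.sum_congr rfl fun j _ => by ring
  calc _ = ∑ i, ∑ j, (a * (n + 2) * (u i * u j * (if i = j then (1 : ℝ) else 0)) +
        u i * u j * ∑ r, S r i j * (∑ k, S r k k) +
        2 * (u i * u j * ∑ r, ∑ k, S r i k * S r j k)) := by
        simp only [e0]
        exact Finset.sum_congr rfl fun i _ => Finset.sum_congr rfl fun j _ => by ring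
    _ = _ := by
        simp only [Finset.sum_add_distrib, ← Finset.mul_sum (a := a * (n + 2)),
          ← Finset.mul_sum (a := (2 : ℝ))]
        rw [e1, e2, e3]

/-- Positivity of the moments. The operator norm bound controls the terms `S_r ⊗ S_r` created by
symmetrisation, which leaves `∑ r, ⟨S_r, M⟩²` to absorb the odd moments. -/
theorem moments_nonneg (hn : 1 ≤ n) (hN : FormBound S N) (hN0 : 0 < N) (u : Fin n → ℝ)
    {M : Fin n → Fin n → ℝ} (hM : ∀ i j, M i j = M j i) :
    0 ≤ ∑ i, ∑ j, u i * u j * ∑ k, fourthMoments (8 * N) S i j k k +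
      2 * ∑ k, ∑ i, ∑ j, u k * M i j * (2 * √(N * n) * S k i j) +
        ∑ i, ∑ j, ∑ k, ∑ l, M i j * M k l * fourthMoments (8 * N) S i j k l := by
  rw [sum_fourthMoments_lin, sum_fourthMoments_quad _ hM]
  have hq := (abs_le.1 (hN fun p => M p.1 p.2)).1
  have hMM : (fun p : Fin n × Fin n => M p.1 p.2) ⬝ᵥ (fun p => M p.1 p.2) =
      ∑ i, ∑ j, M i j ^ 2 := by
    simp [dotProduct, Fintype.sum_prod_type, sq]
  rw [hMM] at hq
  set F := ∑ i, ∑ j, M i j ^ 2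
  set U := ∑ i, u i ^ 2 with hU
  set Q := (fun p : Fin n × Fin n => M p.1 p.2) ⬝ᵥ sqFlat S *ᵥ fun p => M p.1 p.2
  set T := (∑ i, M i i) ^ 2
  set s : Fin n → ℝ := fun r => ∑ i, ∑ j, M i j * S r i j with hs
  set τ : Fin n → ℝ := fun r => ∑ k, S r k k with hτ
  set g : Fin n → ℝ := fun r => ∑ i, ∑ j, u i * u j * S r i j with hg
  set ρ := √(N * n) with hρ
  have hρ2 : ρ ^ 2 = N * n := Real.sq_sqrt (by positivity)
  have hF : 0 ≤ F := by positivity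
  have hU0 : 0 ≤ U := by positivity
  have hT : 0 ≤ T := sq_nonneg _
  have hn' : (1 : ℝ) ≤ n := by exact_mod_cast hn
  have hcross : ∑ k, ∑ i, ∑ j, u k * M i j * (2 * ρ * S k i j) = ∑ k, 2 * ρ * (u k * s k) := by
    refine Finset.sum_congr rfl fun k _ => ?_
    simp only [hs, Finset.mul_sum]
    exact Finset.sum_congr rfl fun i _ => Finset.sum_congr rfl fun j _ => by ring
  have hτg : -(2 * N * n * U) ≤ ∑ r, τ r * g r := by
    have h1 := Finset.sum_mul_sq_le_sq_mul_sq Finset.univ τ g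
    have h2 := sum_sq_trace_le hN hN0.le
    have h3 := sum_sq_form_le hN u
    have h4 : (∑ r, τ r * g r) ^ 2 ≤ (2 * N * n * U) ^ 2 := by
      calc _ ≤ (2 * N * n ^ 2) * (2 * N * U ^ 2) :=
            h1.trans (mul_le_mul h2 h3 (by positivity) (by positivity))
        _ = _ := by ring
    exact (abs_le_of_sq_le_sq' h4 (by positivity)).1
  have hR : 0 ≤ ∑ r, ∑ k, (∑ i, u i * S r i k) ^ 2 := by positivity
  -- completing the square: `∑ r, ⟨S_r, M⟩²` absorbs the odd moments at the cost `4 ρ² ‖u‖²`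
  have hsq : 0 ≤ ∑ k, (s k ^ 2 + 4 * ρ * (u k * s k) + 4 * ρ ^ 2 * u k ^ 2) :=
    Finset.sum_nonneg fun k _ => by nlinarith [sq_nonneg (s k + 2 * ρ * u k)]
  rw [Finset.sum_add_distrib, Finset.sum_add_distrib, ← Finset.mul_sum, ← Finset.mul_sum, ← hU,
    hρ2] at hsq
  rw [hcross, ← Finset.mul_sum]
  have hNF : 0 ≤ N * F := by positivity
  have hNT : 0 ≤ N * T := by positivity
  have hNU : 0 ≤ N * U := by positivity
  nlinarith

/-- Bounds for `totalMass`: `FormBound` at `idVec` and on the traces of the slices shows that the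
uniform part dominates. -/
theorem sum_fourthMoments_diag_bounds (hn : 1 ≤ n) (hN : FormBound S N) (hN0 : 0 < N) :
    0 < ∑ i, ∑ j, fourthMoments (8 * N) S i i j j ∧
      ∑ i, ∑ j, fourthMoments (8 * N) S i i j j ≤ 30 * N * n ^ 2 := by
  have h := sum_fourthMoments_quad (S := S) (8 * N)
    (M := fun i j : Fin n => if i = j then 1 else 0) (fun i j => by simp [eq_comm])
  simp at h
  have hq := abs_le.1 (hN (idVec n))
  have ht := sum_sq_trace_le hN hN0.le
  have ht0 : 0 ≤ ∑ r, (∑ i, S r i i) ^ 2 := by positivity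
  rw [idVec_dotProduct_self] at hq
  simp only [idVec] at hq
  simp at hq
  have hn' : (1 : ℝ) ≤ n := by exact_mod_cast hn
  have hid : (fun p : Fin n × Fin n => if p.1 = p.2 then (1 : ℝ) else 0) = idVec n := rfl
  rw [h, hid]
  have h1 : N * n ≤ N * n ^ 2 := by nlinarith
  have h2 : 0 < N * n := by positivity
  constructor <;> linarith

/-- The total mass of the functional with fourth moments `fourthMoments (8 * N) S`. -/
def totalMass (N : ℝ) (S : Fin n → Fin n → Fin n → ℝ) : ℝ :=
  ∑ i, ∑ j, fourthMoments (8 * N) S i i j j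

/-- The functional attached to the symmetric tensor `S` and the scale `N`: its third moments are
proportional to `S`, its fourth moments to `fourthMoments (8 * N) S`. -/
noncomputable def tensorFunctional (N : ℝ) (S : Fin n → Fin n → Fin n → ℝ) :
    MvPolynomial (Fin n) ℝ →ₗ[ℝ] ℝ :=
  momentFunctional (fun i j k => (totalMass N S)⁻¹ * (2 * √(N * n) * S i j k))
    (fun i j k l => (totalMass N S)⁻¹ * fourthMoments (8 * N) S i j k l)

theorem tensorFunctional_X_mul_X_mul_X (hS : IsSymTensor S) (i j k : Fin n) :
    tensorFunctional N S (X i * X j * X k) = (totalMass N S)⁻¹ * (2 * √(N * n)) * S i j k := by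
  have h₃ : IsSymTensor fun i j k => (totalMass N S)⁻¹ * (2 * √(N * n) * S i j k) :=
    ⟨fun i j k => by rw [hS.swap_left], fun i j k => by rw [hS.swap_right]⟩
  rw [tensorFunctional, momentFunctional_X_mul_X_mul_X h₃]
  ring

/-- The third moments of `tensorFunctional N S` are at least of order
`n ^ (-3 / 2) * N ^ (-1 / 2)` times `S`. -/
theorem le_third_moment_coeff (hn : 1 ≤ n) (hN : FormBound S N) (hN0 : 0 < N) :
    1 / (15 * (n * √n) * √N) ≤ (totalMass N S)⁻¹ * (2 * √(N * n)) := by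
  obtain ⟨hZ0, hZ⟩ := sum_fourthMoments_diag_bounds hn hN hN0
  change 0 < totalMass N S at hZ0
  have hn' : (0 : ℝ) < n := by exact_mod_cast hn
  rw [Real.sqrt_mul hN0.le, inv_mul_eq_div, div_le_div_iff₀ (by positivity) hZ0, one_mul]
  have hsN := Real.mul_self_sqrt hN0.le
  have hsn := Real.mul_self_sqrt hn'.le
  calc totalMass N S ≤ 30 * N * n ^ 2 := hZ
    _ = 30 * (√N * √N) * n * (√n * √n) := by rw [hsN, hsn]; ring
    _ = _ := by ring

theorem isSpherePseudoDist_tensorFunctional (hn : 1 ≤ n) (hS : IsSymTensor S)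
    (hN : FormBound S N) (hN0 : 0 < N) :
    IsSpherePseudoDist ((tensorFunctional N S).domRestrict (PolyLE n 4)) := by
  have hZ0 : 0 < totalMass N S := (sum_fourthMoments_diag_bounds hn hN hN0).1
  have h₃ : IsSymTensor fun i j k => (totalMass N S)⁻¹ * (2 * √(N * n) * S i j k) :=
    ⟨fun i j k => by rw [hS.swap_left], fun i j k => by rw [hS.swap_right]⟩
  have hs := isSymTensor4_fourthMoments (8 * N) hS
  have h₄ : IsSymTensor4 fun i j k l => (totalMass N S)⁻¹ * fourthMoments (8 * N) S i j k l :=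
    ⟨fun i j k l => by rw [hs.swap₁], fun i j k l => by rw [hs.swap₂],
      fun i j k l => by rw [hs.swap₃]⟩
  refine isSpherePseudoDist_momentFunctional hn h₃ h₄ ?_ fun u M hM => ?_
  · simp only [← Finset.mul_sum]
    exact inv_mul_cancel₀ hZ0.ne'
  · have h := mul_nonneg (inv_pos.2 hZ0).le (moments_nonneg hn hN hN0 u hM)
    refine le_of_le_of_eq h ?_
    rw [mul_add, mul_add]
    simp only [Finset.mul_sum]
    refine congrArg₂ (· + ·) (congrArg₂ (· + ·) ?_ ?_) ?_
    · exact Finset.sum_congr rfl fun i _ => Finset.sum_congr rfl fun j _ =>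
        Finset.sum_congr rfl fun k _ => by ring
    · exact Finset.sum_congr rfl fun i _ => Finset.sum_congr rfl fun j _ =>
        Finset.sum_congr rfl fun k _ => by ring
    · exact Finset.sum_congr rfl fun i _ => Finset.sum_congr rfl fun j _ =>
        Finset.sum_congr rfl fun k _ => Finset.sum_congr rfl fun l _ => by ring

end

/-! ### Upper bounds valid for every pseudo-distribution on the sphere -/

/-- A linear functional on all polynomials whose restriction to degree at most four is a
pseudo-distribution on the sphere. Working with such an extension avoids carrying degree proofs
inside its arguments. -/
structure IsSphereFunctional (ℒ : MvPolynomial (Fin n) ℝ →ₗ[ℝ] ℝ) : Prop where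
  map_one : ℒ 1 = 1
  nonneg_sq : ∀ p : MvPolynomial (Fin n) ℝ, p.totalDegree ≤ 2 → 0 ≤ ℒ (p ^ 2)
  sphere : ∀ q : MvPolynomial (Fin n) ℝ, q.totalDegree ≤ 2 → ℒ (spherePoly n * q) = 0

theorem totalDegree_spherePoly_le : (spherePoly n).totalDegree ≤ 2 := by
  rw [spherePoly_eq]
  exact (totalDegree_sub _ _).trans (max_le (totalDegree_quadPoly_le _) (by simp))

theorem IsSpherePseudoDist.exists_extension {L : PolyLE n 4 →ₗ[ℝ] ℝ} (hL : IsSpherePseudoDist L) :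
    ∃ ℒ : MvPolynomial (Fin n) ℝ →ₗ[ℝ] ℝ, IsSphereFunctional ℒ ∧
      ∀ p : PolyLE n 4, L p = ℒ (p : MvPolynomial (Fin n) ℝ) := by
  obtain ⟨ℒ, hℒ⟩ := L.exists_extend
  have h : ∀ p : PolyLE n 4, L p = ℒ (p : MvPolynomial (Fin n) ℝ) := fun p => by
    rw [← hℒ]; rfl
  refine ⟨ℒ, ⟨?_, fun p hp => ?_, fun q hq => ?_⟩, h⟩
  · rw [← hL.isPseudoExpectation.map_one, h]
  · have := hL.isPseudoExpectation.nonneg_sq p (mem_polyLE.2 hp)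
    rwa [h] at this
  · have hm : spherePoly n * q ∈ PolyLE n 4 := by
      rw [mem_polyLE]
      have h1 := totalDegree_mul (spherePoly n) q
      have h2 := totalDegree_spherePoly_le (n := n)
      omega
    have := hL.sphere q hm
    rwa [h] at this

namespace IsSphereFunctional

variable {ℒ : MvPolynomial (Fin n) ℝ →ₗ[ℝ] ℝ}

theorem map_normSq (h : IsSphereFunctional ℒ) : ℒ (∑ i, X i ^ 2) = 1 := by
  have e : (∑ i, X i ^ 2 : MvPolynomial (Fin n) ℝ) = spherePoly n * 1 + 1 := by
    rw [spherePoly]; ring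
  rw [e, map_add, h.sphere 1 (by simp), h.map_one, zero_add]

theorem map_normSq_mul (h : IsSphereFunctional ℒ) {q : MvPolynomial (Fin n) ℝ}
    (hq : q.totalDegree ≤ 2) : ℒ ((∑ i, X i ^ 2) * q) = ℒ q := by
  have e : (∑ i, X i ^ 2) * q = spherePoly n * q + q := by
    rw [spherePoly]; ring
  rw [e, map_add, h.sphere q hq, zero_add]

theorem totalDegree_normSq_le : (∑ i, X i ^ 2 : MvPolynomial (Fin n) ℝ).totalDegree ≤ 2 :=
  totalDegree_finsetSum_le fun i _ => (totalDegree_X_pow i 2).le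

/-- `ℒ ⟨v, x⟩³ ≤ 1` for a unit vector `v`: the sums of squares `(ℓ - ℓ²)²`, `‖x - ℓ v‖²` and
`‖ℓ (x - ℓ v)‖²` with `ℓ = ⟨v, x⟩` give `2 ℒ ℓ³ ≤ ℒ ℓ² + ℒ ℓ⁴` and `ℒ ℓ⁴ ≤ ℒ ℓ² ≤ 1`. -/
theorem map_linForm_pow_three_le (h : IsSphereFunctional ℒ) {v : Fin n → ℝ}
    (hv : ∑ i, v i ^ 2 = 1) : ℒ (linForm v ^ 3) ≤ 1 := by
  set l := linForm v with hl
  have hld : l.totalDegree ≤ 1 := totalDegree_linForm_le v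
  have hl2 : (l ^ 2).totalDegree ≤ 2 := by
    have := totalDegree_pow l 2
    omega
  have hproj : ∑ i, (X i - C (v i) * l) ^ 2 = ∑ i, X i ^ 2 - l ^ 2 := by
    have e : ∀ i : Fin n, (X i - C (v i) * l) ^ 2 =
        X i ^ 2 - 2 * l * (C (v i) * X i) + C (v i ^ 2) * l ^ 2 := fun i => by
      rw [C_pow]; ring
    simp only [e, Finset.sum_add_distrib, Finset.sum_sub_distrib, ← Finset.mul_sum,
      ← Finset.sum_mul, ← map_sum, hv, C_1]
    rw [show ∑ i, C (v i) * X i = l from rfl]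
    ring
  have hpd : ∀ i, (X i - C (v i) * l).totalDegree ≤ 1 := fun i =>
    (totalDegree_sub _ _).trans (max_le (totalDegree_X i).le (totalDegree_C_mul_le _ hld))
  have h1 : ℒ (l ^ 2) ≤ 1 := by
    have : 0 ≤ ℒ (∑ i, (X i - C (v i) * l) ^ 2) := by
      rw [map_sum]
      exact Finset.sum_nonneg fun i _ => h.nonneg_sq _ ((hpd i).trans one_le_two)
    rw [hproj, map_sub, h.map_normSq] at this
    linarith
  have h2 : ℒ (l ^ 4) ≤ ℒ (l ^ 2) := by
    have : 0 ≤ ℒ (∑ i, (l * (X i - C (v i) * l)) ^ 2) := by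
      rw [map_sum]
      refine Finset.sum_nonneg fun i _ => h.nonneg_sq _ ((totalDegree_mul _ _).trans ?_)
      have := hpd i
      omega
    have e : ∑ i, (l * (X i - C (v i) * l)) ^ 2 = (∑ i, X i ^ 2) * l ^ 2 - l ^ 4 := by
      simp only [mul_pow l, ← Finset.mul_sum, hproj]
      ring
    rw [e, map_sub, h.map_normSq_mul hl2] at this
    linarith
  have h3 := h.nonneg_sq (l - l ^ 2)
    ((totalDegree_sub _ _).trans (max_le (hld.trans one_le_two) hl2))
  have e : (l - l ^ 2) ^ 2 = l ^ 2 - (2 : ℝ) • l ^ 3 + l ^ 4 := by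
    rw [smul_eq_C_mul, map_ofNat]; ring
  rw [e, map_add, map_sub, map_smul, smul_eq_mul] at h3
  linarith

/-- A positive semidefinite form in the monomials `x_i x_j` is a sum of squares. -/
theorem sum_mul_map_nonneg (h : IsSphereFunctional ℒ) {R : Matrix (Fin n × Fin n) (Fin n × Fin n) ℝ}
    (hR : R.PosSemidef) :
    0 ≤ ∑ p, ∑ q, R p q * ℒ (X p.1 * X p.2 * (X q.1 * X q.2)) := by
  obtain ⟨m, v, rfl⟩ := Matrix.posSemidef_iff_eq_sum_vecMulVec.1 hR
  have e : ∑ p, ∑ q, (∑ a, Matrix.vecMulVec (v a) (star (v a))) p q *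
        ℒ (X p.1 * X p.2 * (X q.1 * X q.2)) =
      ∑ a, ℒ ((quadPoly fun i j => v a (i, j)) ^ 2) := by
    simp only [Matrix.sum_apply, Matrix.vecMulVec_apply, star_trivial, Finset.sum_mul]
    rw [sum_comm_last₃]
    simp only [sq (quadPoly _), quadPoly_mul_quadPoly, map_sum, map_smul, smul_eq_mul,
      Fintype.sum_prod_type]
  rw [e]
  exact Finset.sum_nonneg fun a _ => h.nonneg_sq _ (totalDegree_quadPoly_le _)

/-- The matrix `N (1 + I Iᵀ) - sqFlat S` is positive semidefinite, and both `1` and `I Iᵀ` stand for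
the polynomial `‖x‖⁴`, of value one. -/
theorem sum_map_sq_quadPoly_le (h : IsSphereFunctional ℒ) {S : Fin n → Fin n → Fin n → ℝ} {N : ℝ}
    (hN : FormBound S N) (hS : IsSymTensor S) : ∑ k, ℒ (quadPoly (S k) ^ 2) ≤ 2 * N := by
  have hR : (N • (1 + Matrix.vecMulVec (idVec n) (idVec n)) - sqFlat S).PosSemidef := by
    refine Matrix.PosSemidef.of_dotProduct_mulVec_nonneg ?_ fun y => ?_
    · rw [Matrix.isHermitian_iff_isSymm]
      ext p q
      simp [Matrix.transpose_apply, Matrix.vecMulVec_apply, Matrix.one_apply,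
        (sqFlat_isSymm hS).apply p q, eq_comm (a := q) (b := p), mul_comm (idVec n q)]
    · have := (abs_le.1 (hN y)).2
      have hid : idVec n ⬝ᵥ y = ∑ i, y (i, i) := by
        simp [idVec, dotProduct, Fintype.sum_prod_type]
      have hid' : y ⬝ᵥ idVec n = ∑ i, y (i, i) := by rw [dotProduct_comm, hid]
      rw [star_trivial, Matrix.sub_mulVec, Matrix.smul_mulVec, Matrix.add_mulVec, Matrix.one_mulVec,
        Matrix.vecMulVec_mulVec, dotProduct_sub, dotProduct_smul, dotProduct_add, hid,
        op_smul_eq_smul, dotProduct_smul, hid', smul_eq_mul, smul_eq_mul, ← sq]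
      linarith
  have h0 := h.sum_mul_map_nonneg hR
  have hn2 : ℒ ((∑ i, X i ^ 2) * ∑ i, X i ^ 2) = 1 := by
    rw [h.map_normSq_mul totalDegree_normSq_le, h.map_normSq]
  have e1 : ∑ p : Fin n × Fin n, ℒ (X p.1 * X p.2 * (X p.1 * X p.2)) = 1 := by
    rw [← hn2, Finset.sum_mul_sum, Fintype.sum_prod_type, map_sum]
    refine Finset.sum_congr rfl fun i _ => ?_
    rw [map_sum]
    exact Finset.sum_congr rfl fun j _ => congrArg ℒ (by ring)
  have e2 : ∑ p : Fin n × Fin n, ∑ q : Fin n × Fin n,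
      idVec n p * idVec n q * ℒ (X p.1 * X p.2 * (X q.1 * X q.2)) = 1 := by
    rw [← hn2, Finset.sum_mul_sum, map_sum]
    simp only [map_sum, idVec, Fintype.sum_prod_type, ite_mul, mul_ite, one_mul, mul_one, zero_mul,
      mul_zero, Finset.sum_ite_eq, Finset.mem_univ, if_true, Finset.sum_ite_irrel,
      Finset.sum_const_zero, sq]
  have e3 : ∑ p : Fin n × Fin n, ∑ q : Fin n × Fin n,
      sqFlat S p q * ℒ (X p.1 * X p.2 * (X q.1 * X q.2)) = ∑ k, ℒ (quadPoly (S k) ^ 2) := by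
    simp only [sqFlat, Matrix.of_apply, Finset.sum_mul]
    rw [sum_comm_last₃]
    refine Finset.sum_congr rfl fun k _ => ?_
    simp only [sq (quadPoly _), quadPoly_mul_quadPoly, map_sum, map_smul, smul_eq_mul,
      Fintype.sum_prod_type]
    refine Finset.sum_congr rfl fun i _ => ?_
    rw [Finset.sum_comm]
    refine Finset.sum_congr rfl fun j _ => Finset.sum_congr rfl fun l _ =>
      Finset.sum_congr rfl fun m _ => congrArg _ (congrArg ℒ (by ring))
  have e : ∀ p q : Fin n × Fin n,
      (N • (1 + Matrix.vecMulVec (idVec n) (idVec n)) - sqFlat S) p q *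
        ℒ (X p.1 * X p.2 * (X q.1 * X q.2)) =
      N * ((if p = q then ℒ (X p.1 * X p.2 * (X q.1 * X q.2)) else 0) +
        idVec n p * idVec n q * ℒ (X p.1 * X p.2 * (X q.1 * X q.2))) -
      sqFlat S p q * ℒ (X p.1 * X p.2 * (X q.1 * X q.2)) := fun p q => by
    simp only [Matrix.sub_apply, Matrix.smul_apply, Matrix.add_apply, Matrix.one_apply,
      Matrix.vecMulVec_apply, smul_eq_mul]
    split_ifs <;> ring
  simp only [e, Finset.sum_sub_distrib, ← Finset.mul_sum, Finset.sum_add_distrib, e2, e3,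
    Finset.sum_ite_eq, Finset.mem_univ, if_true, e1] at h0
  linarith

/-- By Cauchy–Schwarz, `ℒ (∑ k, x_k q_k)² ≤ ℒ ‖x‖² · ∑ k, ℒ q_k²` for the quadratic forms `q_k` of
the slices of `S`. -/
theorem map_cubic_le (h : IsSphereFunctional ℒ) {S : Fin n → Fin n → Fin n → ℝ} {N : ℝ}
    (hN : FormBound S N) (hS : IsSymTensor S) (hN0 : 0 < N) :
    ℒ (∑ k, X k * quadPoly (S k)) ≤ √(2 * N) := by
  have hs : 0 < √(2 * N) := Real.sqrt_pos.2 (by positivity)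
  have hss := Real.mul_self_sqrt (show 0 ≤ 2 * N by positivity)
  have h0 : 0 ≤ ℒ (∑ k, (C √(2 * N) * X k - quadPoly (S k)) ^ 2) := by
    rw [map_sum]
    exact Finset.sum_nonneg fun k _ => h.nonneg_sq _ ((totalDegree_sub _ _).trans
      (max_le (totalDegree_C_mul_le _ ((totalDegree_X k).le.trans one_le_two))
        (totalDegree_quadPoly_le _)))
  have e : ∑ k, (C √(2 * N) * X k - quadPoly (S k)) ^ 2 =
      (2 * N) • (∑ k, X k ^ 2) - (2 * √(2 * N)) • (∑ k, X k * quadPoly (S k)) +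
        ∑ k, quadPoly (S k) ^ 2 := by
    rw [Finset.smul_sum, Finset.smul_sum, ← Finset.sum_sub_distrib, ← Finset.sum_add_distrib]
    refine Finset.sum_congr rfl fun k _ => ?_
    nth_rewrite 2 [← hss]
    simp only [smul_eq_C_mul, C_mul, map_ofNat]
    ring
  rw [e, map_add, map_sub, map_smul, map_smul, h.map_normSq,
    map_sum ℒ (fun k => quadPoly (S k) ^ 2), smul_eq_mul, smul_eq_mul] at h0
  have := h.sum_map_sq_quadPoly_le hN hS
  nlinarith

end IsSphereFunctional

/-! ### Values of the objective -/

theorem sum_symTensor_mul (A : Tensor3 n) {m : Fin n → Fin n → Fin n → ℝ} (hm : IsSymTensor m) :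
    ∑ i, ∑ j, ∑ k, symTensor A i j k * m i j k = 6 * ∑ i, ∑ j, ∑ k, A (i, j, k) * m i j k := by
  have swapL : ∀ f : Fin n → Fin n → Fin n → ℝ,
      ∑ i, ∑ j, ∑ k, f j i k * m i j k = ∑ i, ∑ j, ∑ k, f i j k * m i j k := fun f => by
    rw [Finset.sum_comm]
    exact Finset.sum_congr rfl fun i _ => Finset.sum_congr rfl fun j _ =>
      Finset.sum_congr rfl fun k _ => by rw [hm.swap_left]
  have swapR : ∀ f : Fin n → Fin n → Fin n → ℝ,
      ∑ i, ∑ j, ∑ k, f i k j * m i j k = ∑ i, ∑ j, ∑ k, f i j k * m i j k := fun f => by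
    refine Finset.sum_congr rfl fun i _ => ?_
    rw [Finset.sum_comm]
    exact Finset.sum_congr rfl fun j _ => Finset.sum_congr rfl fun k _ => by rw [hm.swap_right]
  have h1 := swapR fun i j k => A (i, j, k)
  have h2 := swapL fun i j k => A (i, j, k)
  have h3 := (swapL fun i j k => A (i, k, j)).trans h1
  have h4 := (swapR fun i j k => A (j, i, k)).trans h2
  have h5 := (swapR fun i j k => A (j, k, i)).trans h3
  simp only [symTensor, add_mul, Finset.sum_add_distrib]
  linarith

theorem map_tensorPoly (ℒ : MvPolynomial (Fin n) ℝ →ₗ[ℝ] ℝ) (A : Tensor3 n) :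
    6 * ℒ (tensorPoly A) = ∑ i, ∑ j, ∑ k, symTensor A i j k * ℒ (X i * X j * X k) := by
  rw [sum_symTensor_mul A (m := fun i j k => ℒ (X i * X j * X k))
    ⟨fun i j k => congrArg ℒ (by ring), fun i j k => congrArg ℒ (by ring)⟩]
  simp only [tensorPoly, ← smul_eq_C_mul, map_sum, map_smul, smul_eq_mul]

theorem map_sum_X_mul_quadPoly (ℒ : MvPolynomial (Fin n) ℝ →ₗ[ℝ] ℝ)
    (S : Fin n → Fin n → Fin n → ℝ) :
    ℒ (∑ k, X k * quadPoly (S k)) = ∑ i, ∑ j, ∑ k, S i j k * ℒ (X i * X j * X k) := by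
  simp only [quadPoly, Finset.mul_sum, map_sum]
  refine Finset.sum_congr rfl fun i _ => Finset.sum_congr rfl fun j _ =>
    Finset.sum_congr rfl fun k _ => ?_
  rw [← smul_eq_mul (S i j k), ← map_smul, smul_eq_C_mul]
  exact congrArg ℒ (by ring)

theorem map_linForm_pow_three (ℒ : MvPolynomial (Fin n) ℝ →ₗ[ℝ] ℝ) (v : Fin n → ℝ) :
    ℒ (linForm v ^ 3) = ∑ i, ∑ j, ∑ k, v i * (v j * v k) * ℒ (X i * X j * X k) := by
  have e : linForm v ^ 3 = linForm v * quadPoly fun i j => v i * v j := by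
    have : (quadPoly fun i j => v i * v j) = linForm v * linForm v := by
      rw [linForm_mul_linForm]; simp only [quadPoly, smul_eq_C_mul]
    rw [this]; ring
  rw [e, linForm_mul_quadPoly]
  simp only [map_sum, map_smul, smul_eq_mul]

theorem map_objectivePoly (ℒ : MvPolynomial (Fin n) ℝ →ₗ[ℝ] ℝ) (t : ℝ)
    (v : EuclideanSpace ℝ (Fin n)) (A : Tensor3 n) :
    ℒ (objectivePoly t v A) = t * ℒ (linForm v ^ 3) + ℒ (tensorPoly A) := by
  rw [objectivePoly, map_add, ← smul_eq_C_mul, map_smul, smul_eq_mul]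
  rfl

theorem IsSphereFunctional.map_tensorPoly_le {ℒ : MvPolynomial (Fin n) ℝ →ₗ[ℝ] ℝ}
    (h : IsSphereFunctional ℒ) {A : Tensor3 n} {N : ℝ} (hN : FormBound (symTensor A) N)
    (hN0 : 0 < N) : 6 * ℒ (tensorPoly A) ≤ √(2 * N) := by
  rw [map_tensorPoly, ← map_sum_X_mul_quadPoly]
  exact h.map_cubic_le hN (isSymTensor_symTensor A) hN0

theorem neg_sqrt_le_cubic_form {S : Fin n → Fin n → Fin n → ℝ} {N : ℝ} (hN : FormBound S N)
    {v : Fin n → ℝ} (hv : ∑ i, v i ^ 2 = 1) :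
    -√(2 * N) ≤ ∑ i, ∑ j, ∑ k, v i * (v j * v k) * S i j k := by
  have e : ∑ i, ∑ j, ∑ k, v i * (v j * v k) * S i j k =
      ∑ r, v r * ∑ i, ∑ j, v i * v j * S r i j := by
    simp only [Finset.mul_sum, mul_assoc]
  have h1 := sum_sq_form_le hN v
  have h2 := Finset.sum_mul_sq_le_sq_mul_sq Finset.univ v fun r => ∑ i, ∑ j, v i * v j * S r i j
  rw [hv] at h1 h2
  rw [e]
  refine (abs_le.1 (Real.abs_le_sqrt ?_)).1
  linarith

theorem tensorFunctional_tensorPoly (N : ℝ) (A : Tensor3 n) :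
    6 * tensorFunctional N (symTensor A) (tensorPoly A) =
      (totalMass N (symTensor A))⁻¹ * (2 * √(N * n)) * ∑ i, ∑ j, ∑ k, symTensor A i j k ^ 2 := by
  rw [map_tensorPoly]
  simp only [tensorFunctional_X_mul_X_mul_X (isSymTensor_symTensor A), Finset.mul_sum]
  exact Finset.sum_congr rfl fun i _ => Finset.sum_congr rfl fun j _ =>
    Finset.sum_congr rfl fun k _ => by ring

theorem tensorFunctional_linForm_pow_three {S : Fin n → Fin n → Fin n → ℝ} (hS : IsSymTensor S)
    (N : ℝ) (v : Fin n → ℝ) :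
    tensorFunctional N S (linForm v ^ 3) =
      (totalMass N S)⁻¹ * (2 * √(N * n)) * ∑ i, ∑ j, ∑ k, v i * (v j * v k) * S i j k := by
  rw [map_linForm_pow_three]
  simp only [tensorFunctional_X_mul_X_mul_X hS, Finset.mul_sum]
  exact Finset.sum_congr rfl fun i _ => Finset.sum_congr rfl fun j _ =>
    Finset.sum_congr rfl fun k _ => by ring

/-! ### The typical noise tensor -/

/-- The event that `centredFlat A` has operator norm `O(n^{3/2} log n)`. -/
def IsTypical (A : Tensor3 n) : Prop :=
  ∀ y z : Fin n × Fin n → ℝ, (y ⬝ᵥ centredFlat A *ᵥ z) ^ 2 ≤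
    (5000000 * (n * √n) * Real.log n) ^ 2 * ((y ⬝ᵥ y) * (z ⬝ᵥ z))

/-- A constant for which `FormBound` holds for the symmetrised noise on the typical event. -/
noncomputable def noiseLevel (n : ℕ) : ℝ := 10000000 * (n * √n) * Real.log n

theorem half_le_log (hn : 2 ≤ n) : 1 / 2 ≤ Real.log n := by
  have h1 : Real.log 2 ≤ Real.log n :=
    Real.log_le_log (by norm_num) (by exact_mod_cast hn)
  have := Real.log_two_gt_d9
  linarith

theorem noiseLevel_pos (hn : 2 ≤ n) : 0 < noiseLevel n := by
  have h1 := half_le_log hn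
  have h2 : (0 : ℝ) < n := by exact_mod_cast (by omega : 0 < n)
  have : 0 < Real.log n := by linarith
  unfold noiseLevel
  positivity

theorem abs_dotProduct_meanFlat_le (y : Fin n × Fin n → ℝ) :
    |y ⬝ᵥ meanFlat n *ᵥ y| ≤ 6 * (n + 2) * (y ⬝ᵥ y + (∑ i, y (i, i)) ^ 2) := by
  have e : y ⬝ᵥ meanFlat n *ᵥ y =
      6 * (n + 2) * ((∑ i, y (i, i)) ^ 2 + ∑ i, ∑ j, y (i, j) * y (j, i)) := by
    have e1 : ∀ p, (meanFlat n *ᵥ y) p =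
        6 * (n + 2) * ((if p.1 = p.2 then ∑ i, y (i, i) else 0) + y (p.2, p.1)) := fun p => by
      simp [Matrix.mulVec, dotProduct, meanFlat, Fintype.sum_prod_type, mul_add, add_mul,
        Finset.sum_add_distrib, ← Finset.mul_sum, mul_assoc]
    have e2 : ∀ i j, y (i, j) * (6 * (n + 2) * ((if i = j then ∑ i, y (i, i) else 0) + y (j, i))) =
        6 * (n + 2) * ((if i = j then y (i, i) * ∑ i, y (i, i) else 0) + y (i, j) * y (j, i)) :=
      fun i j => by
        split_ifs with h
        · subst h; ring
        · ring
    simp only [dotProduct, e1, e2, Fintype.sum_prod_type, ← Finset.mul_sum, Finset.sum_add_distrib,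
      Finset.sum_ite_eq, Finset.mem_univ, if_true, ← Finset.sum_mul, sq]
  have h2 : |∑ i, ∑ j, y (i, j) * y (j, i)| ≤ y ⬝ᵥ y := by
    have hs : ∑ i, ∑ j, y (j, i) ^ 2 = ∑ i, ∑ j, y (i, j) ^ 2 := Finset.sum_comm
    have hd : y ⬝ᵥ y = ∑ i, ∑ j, (y (i, j) ^ 2 + y (j, i) ^ 2) / 2 := by
      simp only [dotProduct, Fintype.sum_prod_type, ← Finset.sum_div, Finset.sum_add_distrib, hs,
        ← sq]
      ring
    rw [hd]
    refine (Finset.abs_sum_le_sum_abs _ _).trans (Finset.sum_le_sum fun i _ =>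
      (Finset.abs_sum_le_sum_abs _ _).trans (Finset.sum_le_sum fun j _ => ?_))
    rw [abs_le]
    constructor <;> nlinarith [sq_nonneg (y (i, j) - y (j, i)), sq_nonneg (y (i, j) + y (j, i))]
  rw [e, abs_mul, abs_of_nonneg (by positivity : (0 : ℝ) ≤ 6 * (n + 2))]
  refine mul_le_mul_of_nonneg_left ?_ (by positivity)
  refine (abs_add_le _ _).trans ?_
  rw [abs_of_nonneg (sq_nonneg _)]
  linarith

theorem IsTypical.abs_le (hn : 2 ≤ n) {A : Tensor3 n} (hA : IsTypical A)
    (y : Fin n × Fin n → ℝ) :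
    |y ⬝ᵥ centredFlat A *ᵥ y| ≤ 5000000 * (n * √n) * Real.log n * (y ⬝ᵥ y) := by
  have hl := half_le_log hn
  have hy : 0 ≤ y ⬝ᵥ y := Finset.sum_nonneg fun p _ => mul_self_nonneg (y p)
  refine abs_le_of_sq_le_sq ?_ (by positivity)
  calc _ ≤ _ := hA y y
    _ = _ := by ring

theorem sqFlat_symTensor (A : Tensor3 n) : sqFlat (symTensor A) = centredFlat A + meanFlat n := by
  rw [centredFlat, sub_add_cancel]

theorem IsTypical.formBound (hn : 2 ≤ n) {A : Tensor3 n} (hA : IsTypical A) :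
    FormBound (symTensor A) (noiseLevel n) := by
  intro y
  have h1 := hA.abs_le hn y
  have h2 := abs_dotProduct_meanFlat_le y
  have hl := half_le_log hn
  have hn' : (2 : ℝ) ≤ n := by exact_mod_cast hn
  have hs : 1 ≤ √(n : ℝ) := Real.one_le_sqrt.2 (by linarith)
  have hB : 6 * ((n : ℝ) + 2) ≤ 5000000 * (n * √n) * Real.log n := by
    have : (n : ℝ) ≤ n * √n := by nlinarith
    nlinarith
  have hy : 0 ≤ y ⬝ᵥ y := Finset.sum_nonneg fun p _ => mul_self_nonneg (y p)
  have hd : 0 ≤ (∑ i, y (i, i)) ^ 2 := sq_nonneg _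
  rw [sqFlat_symTensor, Matrix.add_mulVec, dotProduct_add]
  refine (abs_add_le _ _).trans ?_
  unfold noiseLevel
  nlinarith [mul_le_mul_of_nonneg_right hB (add_nonneg hy hd),
    mul_nonneg (by positivity : 0 ≤ 5000000 * (n * √n) * Real.log n) hd]

theorem idVec_dotProduct_sqFlat_mulVec (S : Fin n → Fin n → Fin n → ℝ) :
    idVec n ⬝ᵥ sqFlat S *ᵥ idVec n = ∑ r, ∑ i, ∑ j, S r i j ^ 2 := by
  rw [dotProduct_sqFlat_mulVec, ← sum_comm_last₃ fun i j r => S r i j ^ 2]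
  simp only [idVec, ite_mul, one_mul, zero_mul, Finset.sum_ite_irrel, Finset.sum_const_zero,
    Finset.sum_ite_eq, Finset.mem_univ, if_true, sq]

theorem IsTypical.le_sum_sq (hn : 2 ≤ n) {A : Tensor3 n} (hA : IsTypical A)
    (hlog : 5000000 * Real.log n ≤ 3 * √n) :
    3 * (n : ℝ) ^ 3 ≤ ∑ i, ∑ j, ∑ k, symTensor A i j k ^ 2 := by
  have h1 := (_root_.abs_le.1 (hA.abs_le hn (idVec n))).1
  rw [idVec_dotProduct_self] at h1
  have h2 : idVec n ⬝ᵥ meanFlat n *ᵥ idVec n = 6 * (n + 2) * (n + 1) * n := by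
    rw [meanFlat_mulVec_idVec, dotProduct_smul, idVec_dotProduct_self, smul_eq_mul]
  rw [← idVec_dotProduct_sqFlat_mulVec, sqFlat_symTensor, Matrix.add_mulVec, dotProduct_add, h2]
  have hs := Real.mul_self_sqrt (Nat.cast_nonneg (α := ℝ) n)
  have h3 : 5000000 * (n * √n) * Real.log n * n ≤ 3 * (n : ℝ) ^ 3 := by
    calc 5000000 * (n * √n) * Real.log n * n = n ^ 2 * √n * (5000000 * Real.log n) := by ring
      _ ≤ n ^ 2 * √n * (3 * √n) := by gcongr
      _ = 3 * n ^ 2 * (√n * √n) := by ring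
      _ = _ := by rw [hs]; ring
  have hn0 : (0 : ℝ) ≤ n := Nat.cast_nonneg n
  have h4 : 6 * ((n : ℝ) + 2) * (n + 1) * n - 6 * n ^ 3 = 18 * n ^ 2 + 12 * n := by ring
  have : 0 ≤ 18 * (n : ℝ) ^ 2 + 12 * n := by positivity
  linarith

/-- On the typical event both sides are of order `n^{3/4}` up to powers of `log n`: the spike and
the noise contribute at most `t + O(√(noiseLevel n))` to any pseudo-distribution, whereas
`tensorFunctional` has value `≳ ‖symTensor A‖² / (n^{3/2} √(noiseLevel n))` on the noise, of which
the spike can cancel only a small part. -/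
theorem IsTypical.isMaximalUpTo (hn : 2 ≤ n) {A : Tensor3 n} (hA : IsTypical A)
    (hlog : 5000000 * Real.log n ≤ 3 * √n) {t : ℝ} (ht : 0 < t) (ht2 : t ^ 2 = n * √n)
    {v : EuclideanSpace ℝ (Fin n)} (hv : ‖v‖ = 1) :
    IsMaximalUpTo (1200000000 * Real.log n) t v A
      ((tensorFunctional (noiseLevel n) (symTensor A)).domRestrict (PolyLE n 4)) := by
  intro L' hL'
  obtain ⟨ℒ, hℒ, hℒL⟩ := hL'.exists_extension
  have hv' : ∑ i, v i ^ 2 = 1 := by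
    have := EuclideanSpace.norm_sq_eq v
    simpa [hv] using this.symm
  have hl := half_le_log hn
  have hn' : (2 : ℝ) ≤ n := by exact_mod_cast hn
  have hN := hA.formBound hn
  have hN0 := noiseLevel_pos hn
  have hSS := hA.le_sum_sq hn hlog
  set h := √(10000000 * Real.log n) with hh
  have hh2 : h ^ 2 = 10000000 * Real.log n := Real.sq_sqrt (by positivity)
  have hh1 : 1 ≤ h := Real.one_le_sqrt.2 (by linarith)
  have hNe : noiseLevel n = (t * h) ^ 2 := by
    rw [mul_pow, ht2, hh2, noiseLevel]; ring
  have hsN : √(noiseLevel n) = t * h := by rw [hNe]; exact Real.sqrt_sq (by positivity)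
  have hs2N : √(2 * noiseLevel n) ≤ 2 * (t * h) := by
    rw [Real.sqrt_le_left (by positivity), hNe]
    nlinarith [sq_nonneg (t * h)]
  have hsq := Real.mul_self_sqrt (Nat.cast_nonneg (α := ℝ) n)
  have hn3 : (n : ℝ) ^ 3 = t ^ 4 := by
    calc (n : ℝ) ^ 3 = n ^ 2 * n := by ring
      _ = n ^ 2 * (√n * √n) := by rw [hsq]
      _ = (t ^ 2) ^ 2 := by rw [ht2]; ring
      _ = _ := by ring
  -- the logarithmic condition makes the spike too weak to cancel more than half of the noise term
  have hspike : 8 * h ≤ t ^ 2 := by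
    have hr : 100 ≤ √(n : ℝ) := by linarith
    have h1 : h ^ 2 ≤ 6 * √n := by rw [hh2]; linarith
    have h2 : h ≤ √n := by
      refine abs_le_of_sq_le_sq' (a := h) ?_ (Real.sqrt_nonneg _) |>.2
      nlinarith
    rw [ht2]
    nlinarith
  set c := (totalMass (noiseLevel n) (symTensor A))⁻¹ * (2 * √(noiseLevel n * n)) with hc
  have hcl := le_third_moment_coeff (by omega) hN hN0
  rw [← hc, ← ht2, hsN] at hcl
  have hv3 := neg_sqrt_le_cubic_form hN hv'
  have hlower : t / (60 * h) ≤
      tensorFunctional (noiseLevel n) (symTensor A) (objectivePoly t v A) := by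
    have e1 := tensorFunctional_tensorPoly (noiseLevel n) A
    rw [map_objectivePoly, tensorFunctional_linForm_pow_three (isSymTensor_symTensor A)]
    rw [← hc] at e1 ⊢
    set σ := ∑ i, ∑ j, ∑ k, v i * (v j * v k) * symTensor A i j k
    set ν := ∑ i, ∑ j, ∑ k, symTensor A i j k ^ 2
    have e2 : t * (c * σ) + tensorFunctional (noiseLevel n) (symTensor A) (tensorPoly A) =
        c * (t * σ + ν / 6) := by linarith
    have h3 : t ^ 4 / 4 ≤ t * σ + ν / 6 := by
      have h4 : -(2 * t ^ 2 * h) ≤ t * σ := by nlinarith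
      have h5 : 8 * h * t ^ 2 ≤ t ^ 2 * t ^ 2 := by gcongr
      rw [hn3] at hSS
      nlinarith
    rw [e2]
    calc t / (60 * h) = 1 / (15 * t ^ 2 * (t * h)) * (t ^ 4 / 4) := by field_simp; norm_num
      _ ≤ c * (t ^ 4 / 4) := by gcongr
      _ ≤ c * (t * σ + ν / 6) :=
        mul_le_mul_of_nonneg_left h3 (le_trans (by positivity) hcl)
  have hupper : ℒ (objectivePoly t v A) ≤ 2 * t * h := by
    rw [map_objectivePoly]
    have h1 := hℒ.map_tensorPoly_le hN hN0
    have h2 := hℒ.map_linForm_pow_three_le hv'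
    nlinarith [mul_le_mul_of_nonneg_left h2 ht.le, mul_le_mul_of_nonneg_left hh1 ht.le]
  rw [hℒL, LinearMap.domRestrict_apply]
  calc ℒ (objectivePoly t v A) ≤ 2 * t * h := hupper
    _ = 1200000000 * Real.log n * (t / (60 * h)) := by
      have : 1200000000 * Real.log n = 120 * h ^ 2 := by rw [hh2]; ring
      rw [this]; field_simp; norm_num
    _ ≤ _ := by
      refine mul_le_mul_of_nonneg_left hlower (by positivity)

/-! ### The pseudo-distribution chosen from the noise -/

theorem isSpherePseudoDist_aeval {x : Fin n → ℝ} (hx : ∑ i, x i ^ 2 = 1) :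
    IsSpherePseudoDist ((aeval x).toLinearMap.domRestrict (PolyLE n 4)) := by
  refine ⟨⟨?_, fun p hp => ?_⟩, fun q hq => ?_⟩ <;>
    simp only [LinearMap.domRestrict_apply, AlgHom.toLinearMap_apply]
  · simp
  · rw [map_pow]; positivity
  · simp [spherePoly, hx]

open Classical in
/-- The pseudo-distribution attached to the symmetrised noise. For exceptional noise, where the
construction may fail to be positive, it is replaced by evaluation at the first basis vector. -/
noncomputable def noiseDist (n : ℕ) (A : Tensor3 n) : PolyLE n 4 →ₗ[ℝ] ℝ :=
  if IsSpherePseudoDist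
      ((tensorFunctional (noiseLevel n) (symTensor A)).domRestrict (PolyLE n 4)) then
    (tensorFunctional (noiseLevel n) (symTensor A)).domRestrict (PolyLE n 4)
  else
    (aeval fun i : Fin n => if i.val = 0 then (1 : ℝ) else 0).toLinearMap.domRestrict (PolyLE n 4)

theorem isSpherePseudoDist_noiseDist (hn : 1 ≤ n) (A : Tensor3 n) :
    IsSpherePseudoDist (noiseDist n A) := by
  unfold noiseDist
  split_ifs with h
  · exact h
  · refine isSpherePseudoDist_aeval ?_
    rw [Finset.sum_eq_single ⟨0, hn⟩] <;> simp [Fin.ext_iff]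

theorem IsTypical.noiseDist_eq (hn : 2 ≤ n) {A : Tensor3 n} (hA : IsTypical A) :
    noiseDist n A = (tensorFunctional (noiseLevel n) (symTensor A)).domRestrict (PolyLE n 4) :=
  if_pos (isSpherePseudoDist_tensorFunctional (by omega) (isSymTensor_symTensor A)
    (hA.formBound hn) (noiseLevel_pos hn))

theorem exists_forall_log_le : ∃ n₀ : ℕ, ∀ n : ℕ, n₀ ≤ n → 5000000 * Real.log n ≤ 3 * √n := by
  have h := ((isLittleO_log_rpow_atTop (by norm_num : (0 : ℝ) < 1 / 2)).bound
    (by norm_num : (0 : ℝ) < 3 / 5000000))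
  have h2 := tendsto_natCast_atTop_atTop.eventually h
  obtain ⟨n₀, hn₀⟩ := Filter.eventually_atTop.1 h2
  refine ⟨n₀, fun n hn => ?_⟩
  have h3 := hn₀ n hn
  rw [← Real.sqrt_eq_rpow, Real.norm_of_nonneg (Real.sqrt_nonneg _)] at h3
  have := Real.le_norm_self (Real.log n)
  linarith

end SoS

theorem mainTheorem2 :
    ∃ (τ : ℕ → ℝ) (η : (n : ℕ) → SoS.Tensor3 n → (SoS.PolyLE n 4 →ₗ[ℝ] ℝ)),
      (∃ c : ℝ, 0 < c ∧ ∀ n : ℕ, 2 ≤ n →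
        c * ((n : ℝ) ^ (3 / 4 : ℝ) / Real.log n ^ (1 / 4 : ℝ)) ≤ τ n) ∧
      (∀ n : ℕ, 1 ≤ n → ∀ A : SoS.Tensor3 n, SoS.IsSpherePseudoDist (η n A)) ∧
      ∃ (K : ℝ) (k : ℕ) (C : ℝ), 0 < K ∧ ∀ n : ℕ, 2 ≤ n →
        SoS.gaussianTensor n
          {A | ¬ ∀ v₀ : EuclideanSpace ℝ (Fin n), ‖v₀‖ = 1 →
            SoS.IsMaximalUpTo (K * Real.log n ^ k) (τ n) v₀ A (η n A)}
          ≤ ENNReal.ofReal (C / (n : ℝ) ^ 10) := by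
  obtain ⟨n₀, hn₀⟩ := SoS.exists_forall_log_le
  refine ⟨fun n => (n : ℝ) ^ (3 / 4 : ℝ), SoS.noiseDist, ⟨1 / 2, by norm_num, fun n hn => ?_⟩,
    fun n hn A => SoS.isSpherePseudoDist_noiseDist hn A, 1200000000, 1, 2 + (n₀ : ℝ) ^ 10,
    by norm_num, fun n hn => ?_⟩
  · have hl := SoS.half_le_log hn
    have h1 : 1 / 2 ≤ Real.log n ^ (1 / 4 : ℝ) := by
      calc (1 / 2 : ℝ) = (1 / 2) ^ (1 : ℝ) := (Real.rpow_one _).symm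
        _ ≤ (1 / 2) ^ (1 / 4 : ℝ) :=
          Real.rpow_le_rpow_of_exponent_ge (by norm_num) (by norm_num) (by norm_num)
        _ ≤ _ := Real.rpow_le_rpow (by norm_num) hl (by norm_num)
    have h2 : (0 : ℝ) ≤ (n : ℝ) ^ (3 / 4 : ℝ) := by positivity
    rw [← mul_div_assoc, div_le_iff₀ (by linarith)]
    nlinarith
  · have hn' : (0 : ℝ) < n := by exact_mod_cast (by omega : 0 < n)
    rcases le_or_gt n₀ n with h | h
    · have ht2 : ((n : ℝ) ^ (3 / 4 : ℝ)) ^ 2 = n * √n := by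
        rw [← Real.rpow_natCast, ← Real.rpow_mul hn'.le, Real.sqrt_eq_rpow]
        nth_rewrite 2 [← Real.rpow_one (n : ℝ)]
        rw [← Real.rpow_add hn']
        norm_num
      refine (measure_mono fun A hA => ?_).trans ((SoS.gaussianTensor_centredFlat_le hn).trans
        (ENNReal.ofReal_le_ofReal ?_))
      · refine fun hT => hA fun v₀ hv₀ => ?_
        rw [pow_one, SoS.IsTypical.noiseDist_eq hn hT]
        exact SoS.IsTypical.isMaximalUpTo hn hT (hn₀ n h) (by positivity) ht2 hv₀
      · gcongr
        have : (0 : ℝ) ≤ (n₀ : ℝ) ^ 10 := by positivity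
        linarith
    · -- for the finitely many small `n` the bound on the probability is at least one
      have : IsProbabilityMeasure (SoS.gaussianTensor n) := by
        unfold SoS.gaussianTensor; infer_instance
      refine prob_le_one.trans ?_
      rw [← ENNReal.ofReal_one]
      refine ENNReal.ofReal_le_ofReal ?_
      rw [le_div_iff₀ (by positivity), one_mul]
      have : (n : ℝ) ^ 10 ≤ (n₀ : ℝ) ^ 10 := by
        gcongr
      linarith
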